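/- Let $S=\mathbb{R}\times[0,2\pi]$ with coordinates $(x,y)$, and for $i=1,2$ let $g_i=dy^2+f_i(y)\,dx^2$ on $S$, where $f_1(y)=2-\cos y$ and $f_2(y)=2-\cos 2y$. Let $\sigma$ be either the slide $(x,y)\mapsto(x+100,y)$ or the glide reflection $(x,y)\mapsto(x+50,2\pi-y)$ (whose square is the slide). Then the quotients $P_i:S\to M_i=S/\langle\sigma\rangle$, with the metrics induced by $g_i$, are compact real-analytic Riemannian surfaces with boundary (cylinders for the slide, Möbius bands for the glide reflection), and the identification $h:\partial M_1\to\partial M_2$, $h(P_1(z))=P_2(z)$ for $z\in\partial S$, has the following properties. 1. $h$ is a Riemannian isometry of the boundaries with their induced metrics. 2. $M_1$ and $M_2$ have, under $h$, the same lens data. That is: (a) $\tau_2(h(p),h(q))=\tau_1(p,q)$ for all $p,q\in\partial M_1$, where $\tau_i$ is the Riemannian distance function of $M_i$; (b) $dh$ carries $\Omega'_1$ onto $\Omega'_2$ (keeping $T$ fixed), where $\Omega'_i$ is the set of all triples $(\gamma'(0)^{\parallel},\gamma'(T)^{\parallel},T)$ in which $\gamma$ is a unit speed geodesic of $M_i$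 starting at a boundary point with $\gamma'(0)$ pointing inwards ($\langle\gamma'(0),\nu\rangle>0$ for the inward unit normal $\nu$), $T>0$ is the first time at which $\gamma$ hits $\partial M_i$ again, and $v^{\parallel}$ is the orthogonal projection of $v$ to the tangent space of $\partial M_i$. 3. At every $p\in\partial M_1$ the $C^2$ jets (hence the $C^\infty$ jets) of the metrics of $M_1$ at $p$ and of $M_2$ at $h(p)$ are different: there are boundary normal coordinates around $p$ and around $h(p)$ which agree on the boundaries (identified through $h$) and in which $\partial_n^l g_{ij}$, for some $l\le 2$ and some $i,j$, takes different values at $p$ and at $h(p)$. Here boundary normal coordinates of a point $q$ near the boundary are the coordinates of the boundary point closest to $q$, together with $x_n$, the distance from $q$ to the boundary. In particular, there are two compact analytic Riemannian manifolds with isometric boundaries and identical lens data, but with different $C^\infty$ jets at the boundaries. -/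

import Mathlib

open Set
open scoped Manifold ContDiff ENNReal Bundle

noncomputable section

/-- A compact analytic Riemannian manifold with (possibly empty) boundary, of dimension `n`:
a compact Hausdorff space with a real-analytic structure modelled on the half space
`{u ∈ ℝⁿ | 0 ≤ u 0}`, together with a real-analytic Riemannian metric. -/
structure AnalyticRiemannianManifold (n : ℕ) [NeZero n] where
  carrier : Type
  [topologicalSpace : TopologicalSpace carrier]
  [t2Space : T2Space carrier]
  [compactSpace : CompactSpace carrier]
  [chartedSpace : ChartedSpace (EuclideanHalfSpace n) carrier]
  [isManifold : IsManifold (𝓡∂ n) ω carrier]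
  metric : Bundle.ContMDiffRiemannianMetric (𝓡∂ n) ω (EuclideanSpace ℝ (Fin n))
    (fun x : carrier => TangentSpace (𝓡∂ n) x)

namespace AnalyticRiemannianManifold

instance {n : ℕ} [NeZero n] : CoeSort (AnalyticRiemannianManifold n) Type :=
  ⟨AnalyticRiemannianManifold.carrier⟩

attribute [instance] topologicalSpace t2Space compactSpace chartedSpace isManifold

variable {n : ℕ} [NeZero n]

instance (M : AnalyticRiemannianManifold n) :
    Bundle.RiemannianBundle (fun x : M => TangentSpace (𝓡∂ n) x) :=
  ⟨M.metric.toRiemannianMetric⟩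

/-- The boundary `∂M`. -/
def bdry (M : AnalyticRiemannianManifold n) : Set M := (𝓡∂ n).boundary M

/-- The Riemannian distance `τ` of `M`: the infimum of the lengths of the `C¹` paths in `M`. -/
def tau (M : AnalyticRiemannianManifold n) (p q : M) : ℝ≥0∞ :=
  Manifold.riemannianEDist (𝓡∂ n) p q

/-- The distance from `q` to the boundary. -/
def distToBdry (M : AnalyticRiemannianManifold n) (q : M) : ℝ≥0∞ :=
  ⨅ b ∈ M.bdry, M.tau q b

/-! ### Coordinate expressions -/

/-- The component `g_ij` of the metric in the chart `φ`, at the point with coordinates `u`. -/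
def metricCoeff (M : AnalyticRiemannianManifold n)
    (φ : OpenPartialHomeomorph M (EuclideanHalfSpace n)) (u : EuclideanSpace ℝ (Fin n))
    (i j : Fin n) : ℝ :=
  M.metric.inner ((φ.extend (𝓡∂ n)).symm u)
    (mfderivWithin 𝓘(ℝ, EuclideanSpace ℝ (Fin n)) (𝓡∂ n) (φ.extend (𝓡∂ n)).symm
      (range (𝓡∂ n)) u (EuclideanSpace.single i (1 : ℝ)))
    (mfderivWithin 𝓘(ℝ, EuclideanSpace ℝ (Fin n)) (𝓡∂ n) (φ.extend (𝓡∂ n)).symm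
      (range (𝓡∂ n)) u (EuclideanSpace.single j (1 : ℝ)))

/-- The partial derivative `∂_l g_ij` in the chart `φ` (one-sided in the direction normal to
the boundary, at points of the boundary). -/
def metricPartial (M : AnalyticRiemannianManifold n)
    (φ : OpenPartialHomeomorph M (EuclideanHalfSpace n)) (u : EuclideanSpace ℝ (Fin n))
    (l i j : Fin n) : ℝ :=
  fderivWithin ℝ (fun w => M.metricCoeff φ w i j) (range (𝓡∂ n)) u
    (EuclideanSpace.single l (1 : ℝ))

/-- The Christoffel symbol `Γ^k_ij` in the chart `φ`, at the point with coordinates `u`. -/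
def christoffel (M : AnalyticRiemannianManifold n)
    (φ : OpenPartialHomeomorph M (EuclideanHalfSpace n)) (u : EuclideanSpace ℝ (Fin n))
    (k i j : Fin n) : ℝ :=
  (1 / 2) * ∑ l, ((Matrix.of (M.metricCoeff φ u))⁻¹ : Matrix (Fin n) (Fin n) ℝ) k l *
    (M.metricPartial φ u i j l + M.metricPartial φ u j i l - M.metricPartial φ u l i j)

/-! ### Geodesics and lens data -/

/-- The velocity at time `t` of a curve defined on `[0, T]`. -/
def velocity (M : AnalyticRiemannianManifold n) (γ : ℝ → M) (T t : ℝ) :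
    TangentSpace (𝓡∂ n) (γ t) :=
  mfderivWithin 𝓘(ℝ, ℝ) (𝓡∂ n) γ (Icc 0 T) t (1 : ℝ)

/-- `γ : [0, T] → M` is a unit speed geodesic of `M`: it is of class `C²`, has unit speed, and
in the chart around `γ t` satisfies `c''_k + ∑ Γ^k_ij c'_i c'_j = 0` at time `t`.
(The equation does not depend on the chart.) -/
structure IsUnitGeodesic (M : AnalyticRiemannianManifold n) (γ : ℝ → M) (T : ℝ) : Prop where
  contMDiffOn : ContMDiffOn 𝓘(ℝ, ℝ) (𝓡∂ n) 2 γ (Icc 0 T)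
  unit_speed : ∀ t ∈ Icc 0 T, M.metric.inner (γ t) (M.velocity γ T t) (M.velocity γ T t) = 1
  geodesic_equation : ∀ t ∈ Icc 0 T, ∀ k : Fin n,
    let φ := chartAt (EuclideanHalfSpace n) (γ t)
    let c : ℝ → EuclideanSpace ℝ (Fin n) := fun s => φ.extend (𝓡∂ n) (γ s)
    iteratedDerivWithin 2 (fun s => c s k) (Icc 0 T) t +
      ∑ i, ∑ j, M.christoffel φ (c t) k i j *
        derivWithin (fun s => c s i) (Icc 0 T) t * derivWithin (fun s => c s j) (Icc 0 T) t = 0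

/-- The component of a tangent vector at `p` along the coordinate that defines the boundary, in
the preferred chart at `p`. (The tangent space at `p` is, in Mathlib, the model space `ℝⁿ`,
a vector being identified with its coordinates in the preferred chart at `p`.) -/
def normalCoord (M : AnalyticRiemannianManifold n) (p : M) (v : TangentSpace (𝓡∂ n) p) : ℝ :=
  (show EuclideanSpace ℝ (Fin n) from v) 0

/-- For `p ∈ ∂M`: the vector `v ∈ T_p M` is tangent to `∂M`. -/
def IsTangentToBdry (M : AnalyticRiemannianManifold n) (p : M) (v : TangentSpace (𝓡∂ n) p) :
    Prop :=
  M.normalCoord p v = 0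

/-- For `p ∈ ∂M`: `ν` is the inward-pointing unit normal vector of `∂M` at `p`. -/
def IsInwardUnitNormal (M : AnalyticRiemannianManifold n) (p : M)
    (ν : TangentSpace (𝓡∂ n) p) : Prop :=
  M.metric.inner p ν ν = 1 ∧
    (∀ w : TangentSpace (𝓡∂ n) p, M.IsTangentToBdry p w → M.metric.inner p ν w = 0) ∧
    0 < M.normalCoord p ν

/-- For `p ∈ ∂M`: `v` points inwards, i.e. `⟨v, ν⟩ > 0`. -/
def PointsInwards (M : AnalyticRiemannianManifold n) (p : M) (v : TangentSpace (𝓡∂ n) p) :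
    Prop :=
  ∃ ν : TangentSpace (𝓡∂ n) p, M.IsInwardUnitNormal p ν ∧ 0 < M.metric.inner p v ν

/-- For `p ∈ ∂M`: `u` is the orthogonal projection of `v` to the tangent space of `∂M`. -/
def IsBdryProjection (M : AnalyticRiemannianManifold n) (p : M)
    (v u : TangentSpace (𝓡∂ n) p) : Prop :=
  M.IsTangentToBdry p u ∧
    ∀ w : TangentSpace (𝓡∂ n) p, M.IsTangentToBdry p w → M.metric.inner p (v - u) w = 0

/-- The set `Ω'`: all triples `(γ'(0)^∥, γ'(T)^∥, T)` where `γ` is a unit speed geodesic that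
starts at a boundary point with `γ'(0)` pointing inwards, `T > 0` is the first time at which `γ`
hits `∂M` again, and `^∥` is the orthogonal projection to the tangent space of `∂M`. -/
def exitData (M : AnalyticRiemannianManifold n) :
    Set (TangentBundle (𝓡∂ n) M × TangentBundle (𝓡∂ n) M × ℝ) :=
  {d | ∃ (γ : ℝ → M) (T : ℝ) (u₀ : TangentSpace (𝓡∂ n) (γ 0))
      (u₁ : TangentSpace (𝓡∂ n) (γ T)),
    0 < T ∧ M.IsUnitGeodesic γ T ∧
    γ 0 ∈ M.bdry ∧ γ T ∈ M.bdry ∧ (∀ t ∈ Ioo 0 T, γ t ∉ M.bdry) ∧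
    M.PointsInwards (γ 0) (M.velocity γ T 0) ∧
    M.IsBdryProjection (γ 0) (M.velocity γ T 0) u₀ ∧
    M.IsBdryProjection (γ T) (M.velocity γ T T) u₁ ∧
    d = (⟨γ 0, u₀⟩, ⟨γ T, u₁⟩, T)}

/-- A Riemannian isometry `h : ∂M₁ → ∂M₂` of the boundaries with their induced metrics. It is
recorded as a map on `M₁` whose values off `∂M₁` are irrelevant: it restricts to a bijection
`∂M₁ → ∂M₂`, is smooth along `∂M₁`, and its differential along `∂M₁` preserves the inner product
of vectors tangent to `∂M₁`. -/
structure BoundaryIsometry (M₁ M₂ : AnalyticRiemannianManifold n) where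
  toFun : M₁ → M₂
  bijOn : BijOn toFun M₁.bdry M₂.bdry
  contMDiffOn : ContMDiffOn (𝓡∂ n) (𝓡∂ n) ∞ toFun M₁.bdry
  isometry : ∀ p ∈ M₁.bdry, ∀ v w : TangentSpace (𝓡∂ n) p,
    M₁.IsTangentToBdry p v → M₁.IsTangentToBdry p w →
    M₂.metric.inner (toFun p) (mfderivWithin (𝓡∂ n) (𝓡∂ n) toFun M₁.bdry p v)
      (mfderivWithin (𝓡∂ n) (𝓡∂ n) toFun M₁.bdry p w) = M₁.metric.inner p v w

namespace BoundaryIsometry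

variable {M₁ M₂ : AnalyticRiemannianManifold n}

/-- The differential of `h` along `∂M₁`; it is used on vectors tangent to `∂M₁`. -/
def push (h : BoundaryIsometry M₁ M₂) (v : TangentBundle (𝓡∂ n) M₁) :
    TangentBundle (𝓡∂ n) M₂ :=
  ⟨h.toFun v.1, mfderivWithin (𝓡∂ n) (𝓡∂ n) h.toFun M₁.bdry v.1 v.2⟩

/-- When the boundaries are identified through `h`, the manifolds have the same lens data: the
same set `Ω'`, and the same distances between boundary points. -/
def SameLensData (h : BoundaryIsometry M₁ M₂) : Prop :=
  (fun d : TangentBundle (𝓡∂ n) M₁ × TangentBundle (𝓡∂ n) M₁ × ℝ =>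
      (h.push d.1, h.push d.2.1, d.2.2)) '' M₁.exitData = M₂.exitData ∧
    ∀ p ∈ M₁.bdry, ∀ q ∈ M₁.bdry, M₂.tau (h.toFun p) (h.toFun q) = M₁.tau p q

end BoundaryIsometry

/-! ### Jets of the metric at the boundary -/

/-- The vector `u` with the coordinate number `0` replaced by `t`. -/
def withNormal (u : EuclideanSpace ℝ (Fin n)) (t : ℝ) : EuclideanSpace ℝ (Fin n) :=
  WithLp.toLp 2 (Function.update u.ofLp 0 t)

/-- `φ` is a system of boundary normal coordinates: for every `q` in its domain, the coordinate
number `0` of `q` is the distance from `q` to the boundary, and the point of the chart with the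
same other coordinates and coordinate number `0` equal to `0` is a point of `∂M` that is closest
to `q`. -/
structure IsBoundaryNormalChart (M : AnalyticRiemannianManifold n)
    (φ : OpenPartialHomeomorph M (EuclideanHalfSpace n)) : Prop where
  mem_maximalAtlas : φ ∈ IsManifold.maximalAtlas (𝓡∂ n) ω M
  normal_coordinate : ∀ q ∈ φ.source,
    M.distToBdry q = ENNReal.ofReal (φ.extend (𝓡∂ n) q 0)
  foot_mem : ∀ q ∈ φ.source,
    withNormal (φ.extend (𝓡∂ n) q) 0 ∈ (φ.extend (𝓡∂ n)).target
  foot_mem_bdry : ∀ q ∈ φ.source,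
    (φ.extend (𝓡∂ n)).symm (withNormal (φ.extend (𝓡∂ n) q) 0) ∈ M.bdry
  tau_foot : ∀ q ∈ φ.source,
    M.tau q ((φ.extend (𝓡∂ n)).symm (withNormal (φ.extend (𝓡∂ n) q) 0)) = M.distToBdry q

/-- The `l`-th derivative of `g_ij` in the direction normal to the boundary, at the boundary
point `p`, in the boundary normal coordinates `φ`. -/
def jetCoeff (M : AnalyticRiemannianManifold n)
    (φ : OpenPartialHomeomorph M (EuclideanHalfSpace n)) (p : M) (l : ℕ) (i j : Fin n) : ℝ :=
  iteratedDerivWithin l (fun t => M.metricCoeff φ (withNormal (φ.extend (𝓡∂ n) p) t) i j)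
    (Ici 0) 0

/-- The `C^k` jets of `M₁` at `p ∈ ∂M₁` and of `M₂` at `h p ∈ ∂M₂` agree: in boundary normal
coordinates around `p` and `h p` that restrict to the same coordinates on the boundaries
(identified through `h`), the normal derivatives of order at most `k` of the components of the
metrics are the same. -/
def BoundaryIsometry.JetsAgreeAt {M₁ M₂ : AnalyticRiemannianManifold n}
    (h : BoundaryIsometry M₁ M₂) (k : ℕ) (p : M₁) : Prop :=
  ∀ (φ₁ : OpenPartialHomeomorph M₁ (EuclideanHalfSpace n))
    (φ₂ : OpenPartialHomeomorph M₂ (EuclideanHalfSpace n)),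
    M₁.IsBoundaryNormalChart φ₁ → M₂.IsBoundaryNormalChart φ₂ → p ∈ φ₁.source →
    (∀ q ∈ M₁.bdry ∩ φ₁.source, h.toFun q ∈ φ₂.source ∧ φ₂ (h.toFun q) = φ₁ q) →
    ∀ l ≤ k, ∀ i j : Fin n, M₁.jetCoeff φ₁ p l i j = M₂.jetCoeff φ₂ (h.toFun p) l i j

end AnalyticRiemannianManifold

/-! ### Warped strips and their quotients -/

/-- The strip `ℝ × [0, 2π]`, with coordinates `(x, y)`. -/
def strip : Set (ℝ × ℝ) := univ ×ˢ Icc 0 (2 * Real.pi)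

/-- The slide `(x, y) ↦ (x + 100, y)`. -/
def slide : Equiv.Perm (ℝ × ℝ) where
  toFun z := (z.1 + 100, z.2)
  invFun z := (z.1 - 100, z.2)
  left_inv z := by simp
  right_inv z := by simp

/-- The glide reflection `(x, y) ↦ (x + 50, 2π - y)`; its square is the slide. -/
def glide : Equiv.Perm (ℝ × ℝ) where
  toFun z := (z.1 + 50, 2 * Real.pi - z.2)
  invFun z := (z.1 - 50, 2 * Real.pi - z.2)
  left_inv z := by simp
  right_inv z := by simp

/-- `P : ℝ × [0, 2π] → M` exhibits `M` as the quotient of the strip with the Riemannian metric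
`dy² + f(y) dx²` by the group generated by `σ`. -/
structure IsStripQuotient (f : ℝ → ℝ) (σ : Equiv.Perm (ℝ × ℝ))
    (M : AnalyticRiemannianManifold 2) (P : ℝ × ℝ → M) : Prop where
  isQuotientMap : Topology.IsQuotientMap (fun z : strip => P z)
  eq_iff : ∀ z ∈ strip, ∀ w ∈ strip, P z = P w ↔ ∃ k : ℤ, (σ ^ k) z = w
  contMDiffOn : ContMDiffOn 𝓘(ℝ, ℝ × ℝ) (𝓡∂ 2) ω P strip
  mem_bdry_iff : ∀ z ∈ strip, P z ∈ M.bdry ↔ z.2 = 0 ∨ z.2 = 2 * Real.pi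
  metric_eq : ∀ z ∈ strip, ∀ v w : ℝ × ℝ,
    M.metric.inner (P z) (mfderivWithin 𝓘(ℝ, ℝ × ℝ) (𝓡∂ 2) P strip z v)
      (mfderivWithin 𝓘(ℝ, ℝ × ℝ) (𝓡∂ 2) P strip z w) = v.2 * w.2 + f z.2 * (v.1 * w.1)

end

/-!
For both warping functions `f` the quotient of the strip has the same underlying analytic manifold,
with charts `(x, y) ↦ (y, x)` and `(x, y) ↦ (2π - y, x)` up to translations in `x` (the first
coordinate of the half space is the normal one). Only the metric `dy² + f(y) dx²` depends on `f`,
and the boundary isometry is the identity.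

*Lens data.* By Clairaut's relation, `f(y) x'` is a constant `c` along a geodesic, and the unit
speed condition gives `y'² = 1 - c² / f(y)`. A geodesic that enters at the boundary, where `f = 1`
is minimal, has `|c| < 1`, so `y'` never vanishes: the geodesic crosses the strip monotonically
and leaves on the opposite side. Its crossing time is `∫ (1 - c²/f)^(-1/2) dy`, its tangential
displacement is `∫ (c/f) (1 - c²/f)^(-1/2) dy`, and its tangential velocity is `c` at both ends
(`WarpedStrip.mem_exitData_iff`). The integrals only see the distribution of the values of `f`, and
`2 - cos y` and `2 - cos 2y` are equidistributed on `[0, 2π]`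
(`WarpedStrip.integral_cosProfile`), so the sets `Ω'` coincide.

*Boundary distances.* No existence theory for minimizing geodesics is needed. For a function `G`
with `a² / f + G'² ≤ 1`, the function `a x + G(y)` on the strip is `1`-Lipschitz, hence a lower
bound for lengths (`WarpedStrip.calibration_le_pathELength`). With `a = c` and
`G' = (1 - c²/f)^(1/2)` it is a calibration of the crossing geodesic with Clairaut constant `c`.
For points on opposite sides of the strip, every displacement occurs for some `c`: as `c → 1`, the
displacement diverges logarithmically, because `f - 1` vanishes to second order on the boundary
(`WarpedStrip.exists_riseShift_eq`). So the distance in the strip is the crossing time. For points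
on the same side, `a = ±1` and `G = 0` show that the boundary segment is minimizing, as `f ≥ 1`.
Each of these distances is the same for both profiles; the distance in the quotient is the least of
them over all lifts (`WarpedStrip.Profile.Matches.tau_le`).

*Jets.* Vertical segments minimize the distance to the boundary, by the calibration `±y`. So the
charts above, restricted to a small box, are boundary normal coordinates for both metrics
(`WarpedStrip.exists_isBoundaryNormalChart`), and the tangential component of the metric in them
is `f`, whose second derivative at the boundary is `1` for `2 - cos y` and `4` for `2 - cos 2y`.
-/

noncomputable section

namespace WarpedStrip

section

open Topology Filter

/-! ### The strip and its group of deck transformations -/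

/-- The reflection `y ↦ 2π - y` of `[0, 2π]` if `r` is true, the identity otherwise. -/
def flip (r : Bool) (y : ℝ) : ℝ := if r then 2 * Real.pi - y else y

/-- The derivative of `flip r`. -/
def flipSign (r : Bool) : ℝ := if r then -1 else 1

lemma flip_flip (r : Bool) (y : ℝ) : flip r (flip r y) = y := by
  cases r <;> simp [flip]

lemma flip_xor (r s : Bool) (y : ℝ) : flip (xor r s) y = flip r (flip s y) := by
  cases r <;> cases s <;> simp [flip]

lemma flip_mem (r : Bool) {y : ℝ} (hy : y ∈ Icc 0 (2 * Real.pi)) :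
    flip r y ∈ Icc 0 (2 * Real.pi) := by
  cases r
  · exact hy
  · exact ⟨sub_nonneg.2 hy.2, sub_le_self _ hy.1⟩

lemma flipSign_mul_self (r : Bool) : flipSign r * flipSign r = 1 := by
  cases r <;> simp [flipSign]

lemma flip_eq (r : Bool) (y : ℝ) : flip r y = flip r 0 + flipSign r * y := by
  cases r <;> simp [flip, flipSign]
  ring

@[fun_prop] lemma contDiff_flip (r : Bool) {n : WithTop ℕ∞} : ContDiff ℝ n (flip r) := by
  cases r
  · exact contDiff_id
  · exact contDiff_const.sub contDiff_id

@[fun_prop] lemma continuous_flip (r : Bool) : Continuous (flip r) :=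
  (contDiff_flip r (n := 0)).continuous

lemma hasDerivAt_flip (r : Bool) (y : ℝ) : HasDerivAt (flip r) (flipSign r) y := by
  cases r
  · exact hasDerivAt_id y
  · exact (hasDerivAt_id y).const_sub (2 * Real.pi)

/-- The length by which the generator of the deck group translates: `50` for the glide reflection
(`b = true`), `100` for the slide (`b = false`). -/
def period (b : Bool) : ℝ := if b then 50 else 100

lemma period_pos (b : Bool) : 0 < period b := by cases b <;> norm_num [period]

/-- Whether the `k`-th power of the generator reverses the second coordinate. -/
def deckFlip (b : Bool) (k : ℤ) : Bool := b && decide (Odd k)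

lemma deckFlip_add (b : Bool) (k l : ℤ) :
    deckFlip b (k + l) = xor (deckFlip b k) (deckFlip b l) := by
  cases b
  · simp [deckFlip]
  · by_cases hk : Odd k <;> by_cases hl : Odd l <;>
      simp [deckFlip, hk, hl, Int.odd_add, ← Int.not_odd_iff_even]

/-- The `k`-th power of the generator of the deck group: the glide reflection if `b` is true, the
slide otherwise. -/
def deck (b : Bool) (k : ℤ) (z : ℝ × ℝ) : ℝ × ℝ :=
  (z.1 + k * period b, flip (deckFlip b k) z.2)

lemma deck_add (b : Bool) (k l : ℤ) (z : ℝ × ℝ) : deck b (k + l) z = deck b k (deck b l z) := by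
  ext
  · simp [deck]; ring
  · simp [deck, deckFlip_add, flip_xor]

lemma deck_zero (b : Bool) (z : ℝ × ℝ) : deck b 0 z = z := by
  simp [deck, deckFlip, flip]

@[fun_prop] lemma continuous_deck (b : Bool) (k : ℤ) : Continuous (deck b k) := by
  unfold deck; fun_prop

lemma deck_mem_strip (b : Bool) (k : ℤ) {z : ℝ × ℝ} (hz : z ∈ strip) : deck b k z ∈ strip :=
  ⟨mem_univ _, flip_mem _ hz.2⟩

/-- The slide or the glide reflection. -/
def generator (b : Bool) : Equiv.Perm (ℝ × ℝ) := if b then glide else slide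

lemma generator_apply (b : Bool) (z : ℝ × ℝ) : generator b z = deck b 1 z := by
  cases b <;> simp [generator, deck, deckFlip, flip, period, glide, slide]

lemma generator_symm_apply (b : Bool) (z : ℝ × ℝ) : (generator b)⁻¹ z = deck b (-1) z := by
  rw [Equiv.Perm.inv_eq_iff_eq, generator_apply, ← deck_add]
  simp [deck_zero]

lemma generator_zpow_apply (b : Bool) (k : ℤ) (z : ℝ × ℝ) : (generator b ^ k) z = deck b k z := by
  induction k generalizing z with
  | zero => simp [deck_zero]
  | succ n ih => rw [zpow_add_one, Equiv.Perm.mul_apply, ih, generator_apply, ← deck_add]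
  | pred n ih => rw [zpow_sub_one, Equiv.Perm.mul_apply, ih, generator_symm_apply, ← deck_add,
      sub_eq_add_neg]

/-- The strip, as a space on which the deck group labelled by `b` acts. -/
def StripCover (_ : Bool) : Type := strip

variable {b : Bool}

instance : TopologicalSpace (StripCover b) := inferInstanceAs (TopologicalSpace strip)

instance : T2Space (StripCover b) := inferInstanceAs (T2Space strip)

lemma isClosed_strip : IsClosed strip := isClosed_univ.prod isClosed_Icc

instance : LocallyCompactSpace (StripCover b) :=
  isClosed_strip.isClosedEmbedding_subtypeVal.locallyCompactSpace

/-- The underlying point of the plane. -/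
def StripCover.val (z : StripCover b) : ℝ × ℝ := Subtype.val z

lemma StripCover.mem (z : StripCover b) : z.val ∈ strip := Subtype.property z

@[ext] lemma StripCover.ext {z w : StripCover b} (h : z.val = w.val) : z = w := Subtype.ext h

@[fun_prop] lemma StripCover.continuous_val : Continuous (StripCover.val : StripCover b → ℝ × ℝ) :=
  continuous_subtype_val

/-- A point of the strip, from its coordinates. -/
def StripCover.mk (b : Bool) (z : ℝ × ℝ) (hz : z ∈ strip) : StripCover b := ⟨z, hz⟩

@[simp] lemma StripCover.val_mk (z : ℝ × ℝ) (hz : z ∈ strip) : (StripCover.mk b z hz).val = z := rfl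

lemma StripCover.isInducing_val : IsInducing (StripCover.val : StripCover b → ℝ × ℝ) :=
  IsInducing.subtypeVal

instance : MulAction (Multiplicative ℤ) (StripCover b) where
  smul k z := StripCover.mk b (deck b k.toAdd z.val) (deck_mem_strip _ _ z.mem)
  one_smul _ := StripCover.ext (deck_zero b _)
  mul_smul k l _ := StripCover.ext (deck_add b k.toAdd l.toAdd _)

lemma val_smul (k : Multiplicative ℤ) (z : StripCover b) :
    (k • z).val = deck b k.toAdd z.val := rfl

instance : ContinuousConstSMul (Multiplicative ℤ) (StripCover b) where
  continuous_const_smul k := StripCover.isInducing_val.continuous_iff.2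
    ((continuous_deck b k.toAdd).comp StripCover.continuous_val)

instance : IsCancelSMul (Multiplicative ℤ) (StripCover b) := by
  rw [isCancelSMul_iff_eq_one_of_smul_eq]
  intro k z h
  have := congrArg (fun w => (StripCover.val w).1) h
  simpa [val_smul, deck, (period_pos b).ne'] using this

instance : ProperlyDiscontinuousSMul (Multiplicative ℤ) (StripCover b) where
  finite_disjoint_inter_image {K L} hK hL := by
    have hbdd : ∀ K : Set (StripCover b), IsCompact K → ∃ R, ∀ z ∈ K, |z.val.1| ≤ R := by
      intro K hK
      obtain ⟨R, hR⟩ := (hK.image (f := fun z : StripCover b => |z.val.1|)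
        (by fun_prop)).bddAbove
      exact ⟨R, fun z hz => hR ⟨z, hz, rfl⟩⟩
    obtain ⟨R, hR⟩ := hbdd K hK
    obtain ⟨R', hR'⟩ := hbdd L hL
    have hfin : (Icc (-⌈R + R'⌉) ⌈R + R'⌉ : Set ℤ).Finite := finite_Icc _ _
    refine (hfin.preimage (f := Multiplicative.toAdd) Multiplicative.toAdd.injective.injOn).subset ?_
    rintro k ⟨_, ⟨z, hz, rfl⟩, hw⟩
    have h1 := hR z hz
    have h2 := hR' _ hw
    simp only [val_smul, deck] at h2
    have h3 : |(k.toAdd : ℝ) * period b| ≤ R + R' := by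
      calc |(k.toAdd : ℝ) * period b|
          = |(z.val.1 + k.toAdd * period b) - z.val.1| := by ring_nf
        _ ≤ _ := (abs_sub _ _).trans (by linarith)
    have h4 : |(k.toAdd : ℝ)| ≤ R + R' := by
      refine le_trans ?_ h3
      rw [abs_mul, abs_of_pos (period_pos b)]
      have : 1 ≤ period b := by cases b <;> norm_num [period]
      nlinarith [abs_nonneg (k.toAdd : ℝ)]
    rw [abs_le] at h4
    refine ⟨?_, ?_⟩
    · have h5 := Int.le_ceil (R + R')
      have : (-(⌈R + R'⌉ : ℤ) : ℝ) ≤ (k.toAdd : ℝ) := by linarith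
      exact_mod_cast this
    · exact_mod_cast h4.2.trans (Int.le_ceil _)

/-! ### Charts of the strip -/

/-- The coordinates `(flip r y, x + s)` on the strip: the distance to the side `flip r y = 0`,
followed by a coordinate along that side. -/
def coord (r : Bool) (s : ℝ) (z : ℝ × ℝ) : EuclideanSpace ℝ (Fin 2) := !₂[flip r z.2, z.1 + s]

@[simp] lemma coord_zero (r : Bool) (s : ℝ) (z : ℝ × ℝ) : coord r s z 0 = flip r z.2 := rfl

@[simp] lemma coord_one (r : Bool) (s : ℝ) (z : ℝ × ℝ) : coord r s z 1 = z.1 + s := rfl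

/-- The inverse of `coord r s`. -/
def coordInv (r : Bool) (s : ℝ) (u : EuclideanSpace ℝ (Fin 2)) : ℝ × ℝ := (u 1 - s, flip r (u 0))

lemma coordInv_coord (r : Bool) (s : ℝ) (z : ℝ × ℝ) : coordInv r s (coord r s z) = z := by
  simp [coordInv, flip_flip]

lemma coord_coordInv (r : Bool) (s : ℝ) (u : EuclideanSpace ℝ (Fin 2)) :
    coord r s (coordInv r s u) = u := by
  ext i
  fin_cases i <;> simp [coordInv, flip_flip]

@[fun_prop] lemma continuous_coord (r : Bool) (s : ℝ) : Continuous (coord r s) := by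
  unfold coord
  fun_prop

@[fun_prop] lemma continuous_coordInv (r : Bool) (s : ℝ) : Continuous (coordInv r s) := by
  unfold coordInv
  fun_prop

/-- The chart of the strip away from the side `flip r y = 2π`. -/
def stripChart (b r : Bool) : OpenPartialHomeomorph (StripCover b) (EuclideanHalfSpace 2) where
  toFun z := ⟨coord r 0 z.val, (flip_mem r z.mem.2).1⟩
  invFun u := StripCover.mk b (u.1 1, flip r (min (u.1 0) (2 * Real.pi)))
    ⟨mem_univ _, flip_mem r ⟨le_min u.2 Real.two_pi_pos.le, min_le_right _ _⟩⟩
  source := {z | flip r z.val.2 < 2 * Real.pi}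
  target := {u | u.1 0 < 2 * Real.pi}
  map_source' _ hz := hz
  map_target' u hu := by
    change flip r (flip r (min (u.1 0) (2 * Real.pi))) < 2 * Real.pi
    rw [flip_flip]
    exact min_lt_iff.2 (Or.inl hu)
  left_inv' z hz := by
    apply StripCover.ext
    have : flip r z.val.2 ≤ 2 * Real.pi := (flip_mem r z.mem.2).2
    ext <;> simp [min_eq_left this, flip_flip]
  right_inv' u hu := by
    apply Subtype.ext
    ext i
    have hu' : u.1 0 ≤ 2 * Real.pi := le_of_lt hu
    fin_cases i
    · change flip r (flip r (min (u.1 0) (2 * Real.pi))) = u.1 0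
      rw [flip_flip, min_eq_left hu']
    · simp
      rfl
  open_source := isOpen_lt (by fun_prop) continuous_const
  open_target := isOpen_lt (by
    exact (PiLp.continuous_apply 2 (fun _ => ℝ) 0).comp continuous_subtype_val) continuous_const
  continuousOn_toFun := by
    refine (Continuous.subtype_mk ?_ _).continuousOn
    fun_prop
  continuousOn_invFun := by
    refine (StripCover.isInducing_val.continuous_iff.2 ?_).continuousOn
    have h0 : Continuous fun u : EuclideanHalfSpace 2 => u.1 0 :=
      (PiLp.continuous_apply 2 (fun _ => ℝ) 0).comp continuous_subtype_val
    have h1 : Continuous fun u : EuclideanHalfSpace 2 => u.1 1 :=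
      (PiLp.continuous_apply 2 (fun _ => ℝ) 1).comp continuous_subtype_val
    exact h1.prodMk ((continuous_flip r).comp (h0.min continuous_const))

instance : ChartedSpace (EuclideanHalfSpace 2) (StripCover b) where
  atlas := range (stripChart b)
  chartAt z := stripChart b (decide (z.val.2 = 2 * Real.pi))
  mem_chart_source z := by
    have h := z.mem.2
    by_cases hz : z.val.2 = 2 * Real.pi
    · simp [stripChart, flip, hz, Real.pi_pos]
    · simpa [stripChart, flip, hz] using lt_of_le_of_ne h.2 hz
  chart_mem_atlas z := mem_range_self _

end

section

open Topology Filter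

variable {b : Bool}

/-! ### The quotient surface and its charts -/

/-- The cylinder (`b = false`) or Möbius band (`b = true`): the quotient of the strip by the deck
group. -/
abbrev StripQuotient (b : Bool) : Type :=
  MulAction.orbitRel.Quotient (Multiplicative ℤ) (StripCover b)

/-- The covering map from the strip to its quotient. -/
def proj (b : Bool) : StripCover b → StripQuotient b := Quotient.mk _

lemma isQuotientCoveringMap_proj : IsQuotientCoveringMap (proj b) (Multiplicative ℤ) :=
  isQuotientCoveringMap_quotientMk_of_properlyDiscontinuousSMul

lemma isCoveringMap_proj : IsCoveringMap (proj b) := isQuotientCoveringMap_proj.isCoveringMap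

lemma continuous_proj : Continuous (proj b) := isCoveringMap_proj.continuous

lemma proj_eq_iff (z w : StripCover b) : proj b z = proj b w ↔ ∃ k : ℤ, deck b k z.val = w.val := by
  rw [eq_comm, isQuotientCoveringMap_proj.apply_eq_iff_mem_orbit]
  constructor
  · rintro ⟨k, hk⟩
    exact ⟨k.toAdd, congrArg StripCover.val hk⟩
  · rintro ⟨k, hk⟩
    exact ⟨Multiplicative.ofAdd k, StripCover.ext hk⟩

instance : T2Space (StripQuotient b) := t2Space_of_properlyDiscontinuousSMul_of_t2Space

/-- Retraction of the plane onto the strip. -/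
def clamp (b : Bool) (z : ℝ × ℝ) : StripCover b :=
  StripCover.mk b (z.1, max 0 (min z.2 (2 * Real.pi)))
    ⟨mem_univ _, le_max_left _ _, max_le Real.two_pi_pos.le (min_le_right _ _)⟩

lemma continuous_clamp : Continuous (clamp b) :=
  StripCover.isInducing_val.continuous_iff.2
    (continuous_fst.prodMk (continuous_const.max (continuous_snd.min continuous_const)))

lemma clamp_of_mem {z : ℝ × ℝ} (hz : z ∈ strip) : clamp b z = StripCover.mk b z hz := by
  apply StripCover.ext
  have h := hz.2
  ext
  · rfl
  · simp [clamp, h.1, h.2]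

/-- The quotient map, extended to the plane by the retraction onto the strip. -/
def stripProj (b : Bool) (z : ℝ × ℝ) : StripQuotient b := proj b (clamp b z)

lemma stripProj_of_mem {z : ℝ × ℝ} (hz : z ∈ strip) :
    stripProj b z = proj b (StripCover.mk b z hz) := by
  rw [stripProj, clamp_of_mem hz]

lemma stripProj_val (z : StripCover b) : stripProj b z.val = proj b z := stripProj_of_mem z.mem

lemma continuous_stripProj : Continuous (stripProj b) := continuous_proj.comp continuous_clamp

lemma exists_stripProj_eq (q : StripQuotient b) : ∃ z ∈ strip, stripProj b z = q := by
  obtain ⟨z, rfl⟩ := isQuotientCoveringMap_proj.surjective q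
  exact ⟨z.val, z.mem, stripProj_val z⟩

lemma stripProj_eq_iff {z w : ℝ × ℝ} (hz : z ∈ strip) (hw : w ∈ strip) :
    stripProj b z = stripProj b w ↔ ∃ k : ℤ, deck b k z = w := by
  rw [stripProj_of_mem hz, stripProj_of_mem hw, proj_eq_iff]
  rfl

lemma stripProj_deck {z : ℝ × ℝ} (hz : z ∈ strip) (k : ℤ) :
    stripProj b (deck b k z) = stripProj b z :=
  ((stripProj_eq_iff hz (deck_mem_strip b k hz)).2 ⟨k, rfl⟩).symm

instance : CompactSpace (StripQuotient b) := by
  have hK : IsCompact (Icc 0 (period b) ×ˢ Icc 0 (2 * Real.pi)) := isCompact_Icc.prod isCompact_Icc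
  refine ⟨(hK.image (continuous_stripProj (b := b))).of_isClosed_subset isClosed_univ fun q _ => ?_⟩
  obtain ⟨z, hz, rfl⟩ := exists_stripProj_eq q
  have hp := period_pos b
  have h1 := Int.floor_le (z.1 / period b)
  have h2 := Int.lt_floor_add_one (z.1 / period b)
  rw [le_div_iff₀ hp] at h1
  rw [div_lt_iff₀ hp] at h2
  refine ⟨deck b (-⌊z.1 / period b⌋) z, ⟨⟨?_, ?_⟩, flip_mem _ hz.2⟩, stripProj_deck hz _⟩
  · simp [deck]; linarith
  · simp [deck]; linarith

lemma exists_eq_of_mem_atlas {e : OpenPartialHomeomorph (StripQuotient b) (EuclideanHalfSpace 2)}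
    (he : e ∈ atlas (EuclideanHalfSpace 2) (StripQuotient b)) :
    ∃ z₀ r, e = (isCoveringMap_proj.isLocalHomeomorph.localInverseAt z₀).trans (stripChart b r) := by
  obtain ⟨q, rfl⟩ := he
  exact ⟨_, _, rfl⟩

lemma map_clamp_tendsto {z : ℝ × ℝ} (hz : z ∈ strip) :
    Tendsto (clamp b) (𝓝[strip] z) (𝓝 (StripCover.mk b z hz)) := by
  rw [← clamp_of_mem hz]
  exact continuous_clamp.continuousAt.mono_left nhdsWithin_le_nhds

/-- In a neighbourhood of every point, every chart of the atlas is, on the strip, one of the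
coordinate systems `coord r s`. -/
lemma exists_chart_eq_coord {e : OpenPartialHomeomorph (StripQuotient b) (EuclideanHalfSpace 2)}
    (he : e ∈ atlas (EuclideanHalfSpace 2) (StripQuotient b)) {z : ℝ × ℝ} (hz : z ∈ strip)
    (hze : stripProj b z ∈ e.source) :
    ∃ r s, flip r z.2 < 2 * Real.pi ∧ ∀ᶠ w in 𝓝[strip] z,
      stripProj b w ∈ e.source ∧ e.extend (𝓡∂ 2) (stripProj b w) = coord r s w := by
  obtain ⟨z₀, r, rfl⟩ := exists_eq_of_mem_atlas he
  set hf := (isCoveringMap_proj (b := b)).isLocalHomeomorph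
  set ψ := hf.localInverseAt z₀ with hψ
  have hψs : ψ.symm = proj b := hf.localInverseAt_symm _
  have hψp : ∀ q ∈ ψ.source, proj b (ψ q) = q := fun q hq => hf.apply_localInverseAt_of_mem hq
  rw [stripProj_of_mem hz] at hze
  set z' := StripCover.mk b z hz with hz'
  -- the sheet of the covering used by the chart is a translate of the given one
  obtain ⟨hz1, hz2⟩ : proj b z' ∈ ψ.source ∧ ψ (proj b z') ∈ (stripChart b r).source := by
    simpa using hze
  obtain ⟨k, hk⟩ := (proj_eq_iff z' (ψ (proj b z'))).1 (hψp _ hz1).symm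
  have hk' : Multiplicative.ofAdd k • z' = ψ (proj b z') := StripCover.ext hk
  refine ⟨xor r (deckFlip b k), k * period b, ?_, ?_⟩
  · have : flip r (ψ (proj b z')).val.2 < 2 * Real.pi := hz2
    rw [← hk] at this
    rwa [flip_xor]
  have hopen : ∀ᶠ w in 𝓝 z', Multiplicative.ofAdd k • w ∈ ψ.target ∧
      Multiplicative.ofAdd k • w ∈ (stripChart b r).source := by
    have hc : Tendsto (fun w : StripCover b => Multiplicative.ofAdd k • w) (𝓝 z')
        (𝓝 (ψ (proj b z'))) := by
      rw [← hk']
      exact (continuous_const_smul _).tendsto z'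
    exact hc.eventually (Filter.Eventually.and (ψ.open_target.mem_nhds (ψ.map_source hz1))
      ((stripChart b r).open_source.mem_nhds hz2))
  filter_upwards [(map_clamp_tendsto hz).eventually hopen, self_mem_nhdsWithin] with w hw hws
  rw [clamp_of_mem hws] at hw
  set w' := StripCover.mk b w hws
  have hpw : stripProj b w = proj b (Multiplicative.ofAdd k • w') := by
    rw [stripProj_of_mem hws, proj_eq_iff]
    exact ⟨k, rfl⟩
  have hinv : ψ (stripProj b w) = Multiplicative.ofAdd k • w' := by
    rw [hpw, ← hψs, ψ.right_inv hw.1]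
  have hsrc : stripProj b w ∈ ψ.source := by
    rw [hpw, ← hψs]
    exact ψ.map_target hw.1
  refine ⟨?_, ?_⟩
  · rw [OpenPartialHomeomorph.trans_source]
    refine ⟨hsrc, ?_⟩
    rw [mem_preimage, hinv]
    exact hw.2
  · change coord r 0 (ψ (stripProj b w)).val = _
    rw [hinv, val_smul]
    ext i
    fin_cases i
    · simp [deck, flip_xor, w']
    · simp [deck, w']

/-- The local inverses of the charts are, in a neighbourhood of every point, the maps obtained by
composing the quotient map with one of the maps `coordInv r s`. -/
lemma exists_symm_eq_stripProj
    {e : OpenPartialHomeomorph (StripQuotient b) (EuclideanHalfSpace 2)}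
    (he : e ∈ atlas (EuclideanHalfSpace 2) (StripQuotient b)) {z : ℝ × ℝ} (hz : z ∈ strip)
    (hze : stripProj b z ∈ e.source) :
    ∃ r s, e.extend (𝓡∂ 2) (stripProj b z) = coord r s z ∧
      (∀ᶠ w in 𝓝[strip] z,
        stripProj b w ∈ e.source ∧ e.extend (𝓡∂ 2) (stripProj b w) = coord r s w) ∧
      ∀ᶠ v in 𝓝[range (𝓡∂ 2)] (coord r s z), coordInv r s v ∈ strip ∧
        (e.extend (𝓡∂ 2)).symm v = stripProj b (coordInv r s v) := by
  obtain ⟨r, s, hlt, hev⟩ := exists_chart_eq_coord he hz hze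
  have hself := hev.self_of_nhdsWithin hz
  refine ⟨r, s, hself.2, hev, ?_⟩
  have hmem : ∀ᶠ v in 𝓝[range (𝓡∂ 2)] (coord r s z), coordInv r s v ∈ strip := by
    have h2 : ∀ᶠ v : EuclideanSpace ℝ (Fin 2) in 𝓝 (coord r s z), v 0 < 2 * Real.pi :=
      (PiLp.continuous_apply 2 (fun _ => ℝ) 0).continuousAt.eventually_lt continuousAt_const hlt
    filter_upwards [nhdsWithin_le_nhds h2, self_mem_nhdsWithin] with v hv hvr
    rw [range_modelWithCornersEuclideanHalfSpace] at hvr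
    exact ⟨mem_univ _, flip_mem r ⟨hvr, hv.le⟩⟩
  have ht : Tendsto (coordInv r s) (𝓝[range (𝓡∂ 2)] (coord r s z)) (𝓝[strip] z) := by
    refine tendsto_nhdsWithin_iff.2 ⟨?_, hmem⟩
    have := (continuous_coordInv r s).tendsto (coord r s z)
    rw [coordInv_coord] at this
    exact this.mono_left nhdsWithin_le_nhds
  filter_upwards [hmem, ht.eventually hev] with v hv hv'
  refine ⟨hv, ?_⟩
  have hv2 := hv'.2
  rw [coord_coordInv] at hv2
  conv_lhs => rw [← hv2]
  exact e.extend_left_inv hv'.1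

/-- The map `(u₀, u₁) ↦ (flip r u₀, u₁ + s)`; all changes of charts are locally of this form. -/
def transition (r : Bool) (s : ℝ) (u : EuclideanSpace ℝ (Fin 2)) : EuclideanSpace ℝ (Fin 2) :=
  coord r s (u 1, u 0)

/-- The derivative of `transition r s`. -/
def transitionDeriv (r : Bool) : EuclideanSpace ℝ (Fin 2) →L[ℝ] EuclideanSpace ℝ (Fin 2) :=
  LinearMap.toContinuousLinearMap
    { toFun := fun v => !₂[flipSign r * v 0, v 1]
      map_add' := fun v w => by ext i; fin_cases i <;> simp [mul_add]
      map_smul' := fun c v => by ext i; fin_cases i <;> simp [mul_left_comm] }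

@[simp] lemma transitionDeriv_zero (r : Bool) (v : EuclideanSpace ℝ (Fin 2)) :
    transitionDeriv r v 0 = flipSign r * v 0 := rfl

@[simp] lemma transitionDeriv_one (r : Bool) (v : EuclideanSpace ℝ (Fin 2)) :
    transitionDeriv r v 1 = v 1 := rfl

lemma transition_eq (r : Bool) (s : ℝ) (u : EuclideanSpace ℝ (Fin 2)) :
    transition r s u = transitionDeriv r u + coord r s 0 := by
  ext i
  fin_cases i
  · simp [transition, flip_eq r (u 0), add_comm]
  · simp [transition]

lemma contDiff_transition (r : Bool) (s : ℝ) {n : WithTop ℕ∞} : ContDiff ℝ n (transition r s) := by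
  rw [funext (transition_eq r s)]
  exact (transitionDeriv r).contDiff.add contDiff_const

lemma hasFDerivAt_transition (r : Bool) (s : ℝ) (u : EuclideanSpace ℝ (Fin 2)) :
    HasFDerivAt (transition r s) (transitionDeriv r) u := by
  rw [funext (transition_eq r s)]
  exact (transitionDeriv r).hasFDerivAt.add_const _

lemma exists_transition
    {e e' : OpenPartialHomeomorph (StripQuotient b) (EuclideanHalfSpace 2)}
    (he : e ∈ atlas (EuclideanHalfSpace 2) (StripQuotient b))
    (he' : e' ∈ atlas (EuclideanHalfSpace 2) (StripQuotient b)) {q : StripQuotient b}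
    (hq : q ∈ e.source) (hq' : q ∈ e'.source) :
    ∃ r s, e'.extend (𝓡∂ 2) q = transition r s (e.extend (𝓡∂ 2) q) ∧
      ∀ᶠ v in 𝓝[range (𝓡∂ 2)] (e.extend (𝓡∂ 2) q),
        e'.extend (𝓡∂ 2) ((e.extend (𝓡∂ 2)).symm v) = transition r s v := by
  obtain ⟨z, hz, rfl⟩ := exists_stripProj_eq q
  obtain ⟨r, s, h1, -, h2⟩ := exists_symm_eq_stripProj he hz hq
  obtain ⟨r', s', -, h3⟩ := exists_chart_eq_coord he' hz hq'
  have htr : ∀ v, coord r' s' (coordInv r s v) = transition (xor r' r) (s' - s) v := by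
    intro v
    ext i
    fin_cases i
    · simp [coordInv, transition, flip_xor]
    · simp [coordInv, transition]; ring
  rw [h1]
  refine ⟨xor r' r, s' - s, ?_, ?_⟩
  · rw [(h3.self_of_nhdsWithin hz).2, ← htr, coordInv_coord]
  · have ht : Tendsto (coordInv r s) (𝓝[range (𝓡∂ 2)] (coord r s z)) (𝓝[strip] z) := by
      refine tendsto_nhdsWithin_iff.2 ⟨?_, h2.mono fun v hv => hv.1⟩
      have := (continuous_coordInv r s).tendsto (coord r s z)
      rw [coordInv_coord] at this
      exact this.mono_left nhdsWithin_le_nhds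
    filter_upwards [h2, ht.eventually h3] with v hv hv'
    rw [hv.2, hv'.2, htr]

instance : IsManifold (𝓡∂ 2) ω (StripQuotient b) := by
  refine isManifold_of_contDiffOn _ _ _ fun e e' he he' u hu => ?_
  obtain ⟨hu1, hu2⟩ := hu
  obtain ⟨x, rfl⟩ := hu2
  rw [mem_preimage, ModelWithCorners.left_inv, OpenPartialHomeomorph.trans_source] at hu1
  obtain ⟨hx1, hx2⟩ := hu1
  have hx1' : e.symm x ∈ e.source := e.map_target hx1
  obtain ⟨r, s, h1, h2⟩ := exists_transition he he' hx1' hx2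
  have hx3 : e.extend (𝓡∂ 2) (e.symm x) = (𝓡∂ 2) x := by
    simp [e.right_inv hx1]
  rw [hx3] at h1 h2
  refine ContDiffWithinAt.mono (s := range (𝓡∂ 2)) ?_ inter_subset_right
  refine (contDiff_transition r s).contDiffWithinAt.congr_of_eventuallyEq h2 ?_
  change (𝓡∂ 2) (e' (e.symm ((𝓡∂ 2).symm ((𝓡∂ 2) x)))) = _
  rw [ModelWithCorners.left_inv]
  exact h1

end

section

open Topology Filter

variable {b : Bool}

/-! ### The warped metric -/

/-- A warping function `f` for the metric `dy² + f(y) dx²`: real-analytic, symmetric under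
`y ↦ 2π - y`, with minimum `1` attained on the boundary of the strip. -/
structure Profile where
  /-- The warping function. -/
  toFun : ℝ → ℝ
  contDiff : ContDiff ℝ ω toFun
  one_le : ∀ y, 1 ≤ toFun y
  symm : ∀ y, toFun (2 * Real.pi - y) = toFun y
  zero : toFun 0 = 1

instance : CoeFun Profile fun _ => ℝ → ℝ := ⟨Profile.toFun⟩

variable (f : Profile)

lemma Profile.flip_apply (r : Bool) (y : ℝ) : f (flip r y) = f y := by
  cases r
  · rfl
  · exact f.symm y

lemma Profile.pos (y : ℝ) : 0 < f y := zero_lt_one.trans_le (f.one_le y)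

lemma Profile.two_pi : f (2 * Real.pi) = 1 := by
  simpa [f.zero] using f.symm 0

/-- The bilinear form `v₀ w₀ + c v₁ w₁`. -/
def diagForm (c : ℝ) :
    EuclideanSpace ℝ (Fin 2) →L[ℝ] EuclideanSpace ℝ (Fin 2) →L[ℝ] ℝ :=
  (EuclideanSpace.proj 0 : EuclideanSpace ℝ (Fin 2) →L[ℝ] ℝ).smulRight
      (EuclideanSpace.proj 0 : EuclideanSpace ℝ (Fin 2) →L[ℝ] ℝ) +
    c • (EuclideanSpace.proj 1 : EuclideanSpace ℝ (Fin 2) →L[ℝ] ℝ).smulRight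
      (EuclideanSpace.proj 1 : EuclideanSpace ℝ (Fin 2) →L[ℝ] ℝ)

@[simp] lemma diagForm_apply (c : ℝ) (v w : EuclideanSpace ℝ (Fin 2)) :
    diagForm c v w = v 0 * w 0 + c * (v 1 * w 1) := by
  simp [diagForm]

lemma diagForm_pos {c : ℝ} (hc : 0 < c) {v : EuclideanSpace ℝ (Fin 2)} (hv : v ≠ 0) :
    0 < diagForm c v v := by
  rw [diagForm_apply]
  by_contra! hcon
  have h0 : v 0 * v 0 ≤ 0 := by nlinarith [mul_self_nonneg (v 1)]
  have h1 : v 1 * v 1 ≤ 0 := by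
    by_contra! h
    nlinarith [mul_self_nonneg (v 0), mul_pos hc h]
  apply hv
  ext i
  fin_cases i
  · exact mul_self_eq_zero.1 (le_antisymm h0 (mul_self_nonneg _))
  · exact mul_self_eq_zero.1 (le_antisymm h1 (mul_self_nonneg _))

lemma isVonNBounded_diagForm {c : ℝ} (hc : 1 ≤ c) :
    Bornology.IsVonNBounded ℝ {v : EuclideanSpace ℝ (Fin 2) | diagForm c v v < 1} := by
  refine (NormedSpace.isVonNBounded_ball ℝ (EuclideanSpace ℝ (Fin 2)) 1).subset fun v hv => ?_
  have hv' := (diagForm_apply c v v).symm.trans_lt hv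
  have h1 : ‖v‖ ^ 2 < 1 := by
    rw [EuclideanSpace.real_norm_sq_eq, Fin.sum_univ_two]
    nlinarith [mul_self_nonneg (v 1)]
  rw [mem_ball_zero_iff]
  exact (sq_lt_one_iff₀ (norm_nonneg _)).1 h1

lemma diagForm_transitionDeriv (c : ℝ) (r : Bool) (v w : EuclideanSpace ℝ (Fin 2)) :
    diagForm c (transitionDeriv r v) (transitionDeriv r w) = diagForm c v w := by
  have := flipSign_mul_self r
  simp only [diagForm_apply, transitionDeriv_zero, transitionDeriv_one]
  linear_combination v 0 * w 0 * this

lemma contDiff_diagForm {n : WithTop ℕ∞} : ContDiff ℝ n diagForm :=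
  contDiff_const.add (ContinuousLinearMap.contDiff ((1 : ℝ →L[ℝ] ℝ).smulRight _))

/-- The normal coordinate of a point in the preferred chart at that point. -/
def height (q : StripQuotient b) : ℝ := (extChartAt (𝓡∂ 2) q q) 0

/-- The value of the warping function at the point with a given normal coordinate does not depend
on the chart. -/
lemma warp_chart_eq {e : OpenPartialHomeomorph (StripQuotient b) (EuclideanHalfSpace 2)}
    (he : e ∈ atlas (EuclideanHalfSpace 2) (StripQuotient b)) {z : ℝ × ℝ} (hz : z ∈ strip)
    (hze : stripProj b z ∈ e.source) : f (e.extend (𝓡∂ 2) (stripProj b z) 0) = f z.2 := by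
  obtain ⟨r, s, h1, -, -⟩ := exists_symm_eq_stripProj he hz hze
  rw [h1, coord_zero, f.flip_apply]

lemma warp_height {z : ℝ × ℝ} (hz : z ∈ strip) : f (height (stripProj b z)) = f z.2 :=
  warp_chart_eq f (chart_mem_atlas _ _) hz (mem_chart_source _ _)

lemma warp_chart_eq_height {e : OpenPartialHomeomorph (StripQuotient b) (EuclideanHalfSpace 2)}
    (he : e ∈ atlas (EuclideanHalfSpace 2) (StripQuotient b)) {q : StripQuotient b}
    (hq : q ∈ e.source) : f (e.extend (𝓡∂ 2) q 0) = f (height q) := by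
  obtain ⟨z, hz, rfl⟩ := exists_stripProj_eq q
  rw [warp_chart_eq f he hz hq, warp_height f hz]

/-- In every chart of the atlas, the preferred tangent coordinates differ from the coordinates of
the chart at most by the sign of the normal component. -/
lemma exists_coordChange_eq (q₀ : StripQuotient b) {q : StripQuotient b}
    (hq : q ∈ (chartAt (EuclideanHalfSpace 2) q₀).source) :
    ∃ r, (trivializationAt (EuclideanSpace ℝ (Fin 2)) (TangentSpace (𝓡∂ 2)) q₀).symmL ℝ q =
      transitionDeriv r := by
  obtain ⟨r, s, h1, h2⟩ := exists_transition (chart_mem_atlas _ q₀) (chart_mem_atlas _ q) hq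
    (mem_chart_source _ q)
  refine ⟨r, ?_⟩
  rw [TangentBundle.symmL_trivializationAt_eq_core hq]
  have hu : UniqueDiffWithinAt ℝ (range (𝓡∂ 2))
      ((chartAt (EuclideanHalfSpace 2) q₀).extend (𝓡∂ 2) q) :=
    (𝓡∂ 2).uniqueDiffOn _ (by simp)
  exact ((hasFDerivAt_transition r s _).hasFDerivWithinAt.congr_of_eventuallyEq h2
    (by rw [OpenPartialHomeomorph.extend_left_inv _ hq, h1])).fderivWithin hu

/-- The bilinear form `dy² + f(y) dx²` on the tangent space of the quotient, whose elements are
written in the preferred chart. -/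
def tangentForm (q : StripQuotient b) :
    TangentSpace (𝓡∂ 2) q →L[ℝ] TangentSpace (𝓡∂ 2) q →L[ℝ] ℝ :=
  diagForm (f (height q))

/-- The metric induced on the quotient by `dy² + f(y) dx²`. -/
def warpedMetric (b : Bool) : Bundle.ContMDiffRiemannianMetric (𝓡∂ 2) ω
    (EuclideanSpace ℝ (Fin 2)) (fun x : StripQuotient b => TangentSpace (𝓡∂ 2) x) where
  inner q := tangentForm f q
  symm q v w := by
    refine (diagForm_apply _ _ _).trans (Eq.trans ?_ (diagForm_apply _ _ _).symm)
    ring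
  pos q _ hv := diagForm_pos (f.pos _) hv
  isVonNBounded q := isVonNBounded_diagForm (f.one_le _)
  contMDiff := by
    intro q₀
    rw [contMDiffAt_hom_bundle]
    refine ⟨contMDiffAt_id, ?_⟩
    have hB : ContMDiffAt (𝓡∂ 2) 𝓘(ℝ, EuclideanSpace ℝ (Fin 2) →L[ℝ] EuclideanSpace ℝ (Fin 2)
        →L[ℝ] ℝ) ω (fun q => diagForm (f (extChartAt (𝓡∂ 2) q₀ q 0))) q₀ := by
      have h1 : ContDiff ℝ ω fun u : EuclideanSpace ℝ (Fin 2) => diagForm (f (u 0)) :=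
        contDiff_diagForm.comp (f.contDiff.comp (contDiff_piLp_apply (p := 2)))
      exact h1.contMDiff.contMDiffAt.comp q₀ contMDiffAt_extChartAt
    refine hB.congr_of_eventuallyEq ?_
    filter_upwards [chart_source_mem_nhds (EuclideanHalfSpace 2) q₀] with q hq
    obtain ⟨r, hr⟩ := exists_coordChange_eq q₀ hq
    ext v w
    refine (inCoordinates_apply_eq₂ (E₃ := Bundle.Trivial (StripQuotient b) ℝ) (F₃ := ℝ)
      hq hq (mem_univ _)).trans ?_
    have hv : ∀ v : EuclideanSpace ℝ (Fin 2),
        (trivializationAt (EuclideanSpace ℝ (Fin 2)) (TangentSpace (𝓡∂ 2)) q₀).symm q v =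
          transitionDeriv r v := fun v =>
      (Bundle.Trivialization.symmL_apply _ hq v).symm.trans (congrArg (fun L => L v) hr)
    rw [hv v, hv w]
    refine (congrArg (fun L : ℝ →ₗ[ℝ] ℝ =>
      L (tangentForm f q (transitionDeriv r v) (transitionDeriv r w)))
      (Bundle.Trivial.linearMapAt_trivialization ℝ (StripQuotient b) ℝ q)).trans ?_
    change diagForm (f (height q)) (transitionDeriv r v) (transitionDeriv r w) = _
    rw [diagForm_transitionDeriv, ← warp_chart_eq_height f (chart_mem_atlas _ q₀) hq]
    rfl

end

section

open Topology Filter AnalyticRiemannianManifold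

variable {b : Bool} (f : Profile)

/-- The quotient of the strip with the metric `dy² + f(y) dx²` by the deck group. -/
def surface (b : Bool) (f : Profile) : AnalyticRiemannianManifold 2 where
  carrier := StripQuotient b
  metric := warpedMetric f b

/-! ### Maps into the quotient that factor through the strip -/

/-- The derivative of `coord r s`. -/
def coordDeriv (r : Bool) : ℝ × ℝ →L[ℝ] EuclideanSpace ℝ (Fin 2) :=
  LinearMap.toContinuousLinearMap
    { toFun := fun v => !₂[flipSign r * v.2, v.1]
      map_add' := fun v w => by ext i; fin_cases i <;> simp [mul_add]
      map_smul' := fun c v => by ext i; fin_cases i <;> simp [mul_left_comm] }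

@[simp] lemma coordDeriv_zero (r : Bool) (v : ℝ × ℝ) : coordDeriv r v 0 = flipSign r * v.2 := rfl

@[simp] lemma coordDeriv_one (r : Bool) (v : ℝ × ℝ) : coordDeriv r v 1 = v.1 := rfl

lemma coord_eq (r : Bool) (s : ℝ) (z : ℝ × ℝ) : coord r s z = coordDeriv r z + coord r s 0 := by
  ext i
  fin_cases i
  · simp [flip_eq r z.2, add_comm]
  · simp

lemma contDiff_coord (r : Bool) (s : ℝ) {n : WithTop ℕ∞} : ContDiff ℝ n (coord r s) := by
  rw [funext (coord_eq r s)]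
  exact (coordDeriv r).contDiff.add contDiff_const

lemma contDiff_coordInv (r : Bool) (s : ℝ) {n : WithTop ℕ∞} : ContDiff ℝ n (coordInv r s) :=
  ((contDiff_piLp_apply (p := 2)).sub contDiff_const).prodMk
    ((contDiff_flip r).comp (contDiff_piLp_apply (p := 2)))

lemma hasFDerivAt_coord (r : Bool) (s : ℝ) (z : ℝ × ℝ) :
    HasFDerivAt (coord r s) (coordDeriv r) z := by
  rw [funext (coord_eq r s)]
  exact (coordDeriv r).hasFDerivAt.add_const _

lemma diagForm_coordDeriv (c : ℝ) (r : Bool) (v w : ℝ × ℝ) :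
    diagForm c (coordDeriv r v) (coordDeriv r w) = v.2 * w.2 + c * (v.1 * w.1) := by
  have := flipSign_mul_self r
  simp only [diagForm_apply, coordDeriv_zero, coordDeriv_one]
  linear_combination v.2 * w.2 * this

lemma exists_extChartAt_eq {z : ℝ × ℝ} (hz : z ∈ strip) {q : StripQuotient b}
    (hq : q = stripProj b z) :
    ∃ r s, flip r z.2 < 2 * Real.pi ∧
      ∀ᶠ w in 𝓝[strip] z, extChartAt (𝓡∂ 2) q (stripProj b w) = coord r s w := by
  subst hq
  obtain ⟨r, s, h1, h2⟩ := exists_chart_eq_coord (chart_mem_atlas _ (stripProj b z)) hz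
    (mem_chart_source _ _)
  exact ⟨r, s, h1, h2.mono fun w hw => hw.2⟩

section

variable {F : Type*} [NormedAddCommGroup F] [NormedSpace ℝ F] {γ : F → StripQuotient b}
  {c : F → ℝ × ℝ} {s : Set F} {t : F}

omit [NormedSpace ℝ F] in
lemma eventually_extChartAt_eq (hγ : ∀ t ∈ s, c t ∈ strip ∧ γ t = stripProj b (c t))
    (hc : ContinuousWithinAt c s t) {r : Bool} {a : ℝ}
    (h : ∀ᶠ w in 𝓝[strip] (c t), extChartAt (𝓡∂ 2) (γ t) (stripProj b w) = coord r a w) :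
    ∀ᶠ t' in 𝓝[s] t, extChartAt (𝓡∂ 2) (γ t) (γ t') = coord r a (c t') := by
  have ht : Tendsto c (𝓝[s] t) (𝓝[strip] (c t)) :=
    tendsto_nhdsWithin_iff.2 ⟨hc, eventually_nhdsWithin_of_forall fun t' ht' => (hγ t' ht').1⟩
  filter_upwards [ht.eventually h, self_mem_nhdsWithin] with t' h1 h2
  rw [(hγ t' h2).2, h1]

/-- In the preferred chart, the differential of `stripProj ∘ c` is that of `c`, up to the sign of
the normal component. -/
lemma hasMFDerivWithinAt_of_lift (ht : t ∈ s)
    (hγ : ∀ t ∈ s, c t ∈ strip ∧ γ t = stripProj b (c t))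
    {L : F →L[ℝ] ℝ × ℝ} (hc : HasFDerivWithinAt c L s t) {r : Bool} {a : ℝ}
    (h : ∀ᶠ w in 𝓝[strip] (c t), extChartAt (𝓡∂ 2) (γ t) (stripProj b w) = coord r a w) :
    HasMFDerivWithinAt 𝓘(ℝ, F) (𝓡∂ 2) γ s t ((coordDeriv r).comp L) := by
  have hev := eventually_extChartAt_eq hγ hc.continuousWithinAt h
  refine ⟨?_, ?_⟩
  · have : ContinuousWithinAt (fun t => stripProj b (c t)) s t :=
      continuous_stripProj.continuousAt.comp_continuousWithinAt hc.continuousWithinAt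
    exact this.congr (fun t' ht' => (hγ t' ht').2) (hγ t ht).2
  · simp only [mfld_simps]
    exact ((hasFDerivAt_coord r a (c t)).comp_hasFDerivWithinAt t hc).congr_of_eventuallyEq hev
      (hev.self_of_nhdsWithin ht)

lemma contMDiffOn_stripProj {n : WithTop ℕ∞} :
    ContMDiffOn 𝓘(ℝ, ℝ × ℝ) (𝓡∂ 2) n (stripProj b) strip := by
  intro z hz
  obtain ⟨r, a, -, h⟩ := exists_extChartAt_eq (b := b) hz rfl
  rw [contMDiffWithinAt_iff]
  refine ⟨continuous_stripProj.continuousWithinAt, ?_⟩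
  simp only [mfld_simps]
  exact (contDiff_coord r a).contDiffWithinAt.congr_of_eventuallyEq h (h.self_of_nhdsWithin hz)

lemma contMDiffOn_of_lift {n : WithTop ℕ∞}
    (hγ : ∀ t ∈ s, c t ∈ strip ∧ γ t = stripProj b (c t)) (hc : ContDiffOn ℝ n c s) :
    ContMDiffOn 𝓘(ℝ, F) (𝓡∂ 2) n γ s :=
  (contMDiffOn_stripProj.comp hc.contMDiffOn fun t ht => (hγ t ht).1).congr
    fun t ht => (hγ t ht).2

/-- A continuous lift of a `Cⁿ` map is `Cⁿ`. -/
lemma contDiffOn_lift {n : WithTop ℕ∞}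
    (hγ : ∀ t ∈ s, c t ∈ strip ∧ γ t = stripProj b (c t)) (hc : ContinuousOn c s)
    (h : ContMDiffOn 𝓘(ℝ, F) (𝓡∂ 2) n γ s) : ContDiffOn ℝ n c s := by
  intro t ht
  obtain ⟨r, a, -, h1⟩ := exists_extChartAt_eq (hγ t ht).1 (hγ t ht).2
  have hev := eventually_extChartAt_eq hγ (hc t ht) h1
  have h2 := ((contMDiffWithinAt_iff.1 (h t ht)).2)
  simp only [mfld_simps] at h2
  have h3 : ContDiffWithinAt ℝ n (fun t' => coord r a (c t')) s t :=
    h2.congr_of_eventuallyEq (hev.mono fun _ h => h.symm) (hev.self_of_nhdsWithin ht).symm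
  refine ((contDiff_coordInv r a).contDiffAt.comp_contDiffWithinAt t h3).congr
    (fun t' _ => ?_) ?_ <;> simp [coordInv_coord]

end

lemma uniqueDiffOn_strip : UniqueDiffOn ℝ strip :=
  uniqueDiffOn_univ.prod (uniqueDiffOn_Icc Real.two_pi_pos)

lemma mem_bdry_iff {z : ℝ × ℝ} (hz : z ∈ strip) {q : StripQuotient b} (hq : q = stripProj b z) :
    q ∈ (surface b f).bdry ↔ z.2 = 0 ∨ z.2 = 2 * Real.pi := by
  obtain ⟨r, a, h1, h2⟩ := exists_extChartAt_eq hz hq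
  have h3 := h2.self_of_nhdsWithin hz
  rw [← hq] at h3
  change extChartAt (𝓡∂ 2) q q ∈ frontier (range (𝓡∂ 2)) ↔ _
  rw [frontier_range_modelWithCornersEuclideanHalfSpace, mem_ofPred_eq, h3, coord_zero]
  have := Real.two_pi_pos
  cases r <;> simp only [flip, Bool.false_eq_true, if_true, if_false] at * <;>
    constructor <;> intro h
  · exact Or.inl h.symm
  · exact (h.resolve_right h1.ne).symm
  · exact Or.inr (by linarith)
  · rcases h with h | h <;> linarith

lemma isStripQuotient_surface (b : Bool) (f : Profile) :
    IsStripQuotient f (generator b) (surface b f) (stripProj b) where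
  isQuotientMap := by
    have : (fun z : strip => stripProj b z) = proj b := funext fun z => stripProj_val (b := b) z
    rw [this]
    exact isQuotientCoveringMap_proj.toIsQuotientMap
  eq_iff z hz w hw := by
    simp only [generator_zpow_apply]
    exact stripProj_eq_iff hz hw
  contMDiffOn := contMDiffOn_stripProj
  mem_bdry_iff z hz := mem_bdry_iff f hz rfl
  metric_eq z hz v w := by
    obtain ⟨r, a, -, h⟩ := exists_extChartAt_eq (b := b) hz rfl
    have hd := hasMFDerivWithinAt_of_lift (b := b) (γ := stripProj b) (c := id) hz
      (fun t ht => ⟨ht, rfl⟩) (hasFDerivWithinAt_id z strip) h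
    have hd' := hd.mfderivWithin (uniqueDiffOn_strip.uniqueMDiffOn z hz)
    refine (congrArg (fun L => diagForm (f (height (stripProj b z))) (L v) (L w)) hd').trans ?_
    refine (diagForm_coordDeriv _ _ _ _).trans ?_
    rw [warp_height f hz]

end

section

open Topology Filter AnalyticRiemannianManifold MeasureTheory

variable {b : Bool} (f : Profile)

/-! ### Lifts of curves, their speed and their length -/

/-- Curves in the quotient lift to the strip. -/
lemma exists_lift {T : ℝ} (hT : 0 < T) {γ : ℝ → StripQuotient b} (hγ : ContinuousOn γ (Icc 0 T))
    {z : ℝ × ℝ} (hz : z ∈ strip) (h0 : γ 0 = stripProj b z) :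
    ∃ c : ℝ → ℝ × ℝ, ContinuousOn c (Icc 0 T) ∧ c 0 = z ∧
      ∀ t ∈ Icc 0 T, c t ∈ strip ∧ γ t = stripProj b (c t) := by
  have hmem : ∀ u : unitInterval, T * u ∈ Icc 0 T := fun u =>
    ⟨mul_nonneg hT.le u.2.1, mul_le_of_le_one_right hT.le u.2.2⟩
  let γ' : C(unitInterval, StripQuotient b) :=
    ⟨fun u => γ (T * u), hγ.comp_continuous (by fun_prop) hmem⟩
  obtain ⟨Γ, h1, h2⟩ := isCoveringMap_proj.exists_path_lifts γ' (StripCover.mk b z hz)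
    (by rw [← stripProj_of_mem hz, ← h0]; simp [γ'])
  refine ⟨fun t => (Γ (projIcc 0 1 zero_le_one (t / T))).val, ?_, ?_, fun t ht => ?_⟩
  · refine Continuous.continuousOn ?_
    exact StripCover.continuous_val.comp (Γ.continuous.comp
      (continuous_projIcc.comp (continuous_id.div_const T)))
  · have : projIcc (0 : ℝ) 1 zero_le_one (0 / T) = 0 := by simp
    change (Γ (projIcc 0 1 zero_le_one (0 / T))).val = z
    rw [this, h2]
    rfl
  · refine ⟨StripCover.mem _, ?_⟩
    rw [stripProj_val]
    have h3 : t / T ∈ Icc (0 : ℝ) 1 := ⟨div_nonneg ht.1 hT.le, div_le_one_of_le₀ ht.2 hT.le⟩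
    have := congrFun h1 (projIcc 0 1 zero_le_one (t / T))
    rw [Function.comp_apply] at this
    rw [this, projIcc_of_mem _ h3]
    change γ t = γ (T * (t / T))
    rw [mul_div_cancel₀ _ hT.ne']

lemma enorm_tangent {n : ℕ} [NeZero n] (M : AnalyticRiemannianManifold n) (p : M)
    (v : TangentSpace (𝓡∂ n) p) : ‖v‖ₑ = ENNReal.ofReal √(M.metric.inner p v v) := by
  rw [← ofReal_norm, norm_eq_sqrt_real_inner]
  rfl

section

variable {γ : ℝ → surface b f} {c : ℝ → ℝ × ℝ} {T t : ℝ}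

/-- The velocity of a curve in the preferred chart, from the velocity of a lift. -/
lemma exists_velocity_eq (hT : 0 < T) (ht : t ∈ Icc 0 T)
    (hγ : ∀ t ∈ Icc 0 T, c t ∈ strip ∧ γ t = stripProj b (c t))
    {c' : ℝ × ℝ} (hc : HasDerivWithinAt c c' (Icc 0 T) t) {r : Bool} {a : ℝ}
    (h : ∀ᶠ w in 𝓝[strip] (c t), extChartAt (𝓡∂ 2) (γ t) (stripProj b w) = coord r a w) :
    (surface b f).velocity γ T t = coordDeriv r c' := by
  have h1 := hasMFDerivWithinAt_of_lift (b := b) (γ := γ) ht hγ hc.hasFDerivWithinAt h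
  have h2 := h1.mfderivWithin ((uniqueDiffOn_Icc hT).uniqueMDiffOn t ht)
  refine (congrArg (fun L => L (1 : ℝ)) h2).trans ?_
  exact congrArg (coordDeriv r) (one_smul ℝ c')

lemma inner_velocity (hT : 0 < T) (ht : t ∈ Icc 0 T)
    (hγ : ∀ t ∈ Icc 0 T, c t ∈ strip ∧ γ t = stripProj b (c t))
    {c' : ℝ × ℝ} (hc : HasDerivWithinAt c c' (Icc 0 T) t) :
    (surface b f).metric.inner (γ t) ((surface b f).velocity γ T t)
      ((surface b f).velocity γ T t) = c'.2 ^ 2 + f (c t).2 * c'.1 ^ 2 := by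
  obtain ⟨r, a, -, h⟩ := exists_extChartAt_eq (hγ t ht).1 (hγ t ht).2
  rw [exists_velocity_eq f hT ht hγ hc h]
  refine (diagForm_coordDeriv _ _ _ _).trans ?_
  have : f (height (γ t)) = f (c t).2 := by
    rw [show γ t = stripProj b (c t) from (hγ t ht).2, warp_height f (hγ t ht).1]
  rw [this]
  ring

lemma enorm_mfderivWithin (hT : 0 < T) (ht : t ∈ Icc 0 T)
    (hγ : ∀ t ∈ Icc 0 T, c t ∈ strip ∧ γ t = stripProj b (c t))
    {c' : ℝ × ℝ} (hc : HasDerivWithinAt c c' (Icc 0 T) t) :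
    ‖mfderivWithin 𝓘(ℝ, ℝ) (𝓡∂ 2) γ (Icc 0 T) t (1 : ℝ)‖ₑ =
      ENNReal.ofReal √(c'.2 ^ 2 + f (c t).2 * c'.1 ^ 2) :=
  (enorm_tangent _ _ _).trans (by rw [← inner_velocity f hT ht hγ hc]; rfl)

/-- A curve of the strip with unit speed bounds the distance of its end points in the quotient. -/
lemma tau_le_of_unit_speed (hT : 0 ≤ T) {x y : ℝ → ℝ} {x' y' : ℝ → ℝ}
    (hx : ∀ t ∈ Icc 0 T, HasDerivWithinAt x (x' t) (Icc 0 T) t)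
    (hy : ∀ t ∈ Icc 0 T, HasDerivWithinAt y (y' t) (Icc 0 T) t)
    (hx' : ContinuousOn x' (Icc 0 T)) (hy' : ContinuousOn y' (Icc 0 T))
    (hmem : ∀ t ∈ Icc 0 T, (x t, y t) ∈ strip)
    (hspeed : ∀ t ∈ Icc 0 T, y' t ^ 2 + f (y t) * x' t ^ 2 = 1) :
    (surface b f).tau (stripProj b (x 0, y 0)) (stripProj b (x T, y T)) ≤ ENNReal.ofReal T := by
  rcases hT.eq_or_lt with rfl | hT
  · exact Manifold.riemannianEDist_self.trans_le zero_le
  let c : ℝ → ℝ × ℝ := fun t => (x t, y t)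
  let γ : ℝ → surface b f := fun t => stripProj b (c t)
  have hγ : ∀ t ∈ Icc 0 T, c t ∈ strip ∧ γ t = stripProj b (c t) := fun t ht => ⟨hmem t ht, rfl⟩
  have hc : ∀ t ∈ Icc 0 T, HasDerivWithinAt c (x' t, y' t) (Icc 0 T) t := fun t ht =>
    (hx t ht).prodMk (hy t ht)
  have hsmooth : ContDiffOn ℝ 1 c (Icc 0 T) := by
    have := contDiffOn_one_iff_derivWithin (𝕜 := ℝ) (f := c) (uniqueDiffOn_Icc hT)
    rw [this]
    refine ⟨fun t ht => (hc t ht).differentiableWithinAt, (hx'.prodMk hy').congr fun t ht => ?_⟩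
    exact (hc t ht).derivWithin (uniqueDiffOn_Icc hT t ht)
  have h1 : ContMDiffOn 𝓘(ℝ, ℝ) (𝓡∂ 2) 1 γ (Icc 0 T) := contMDiffOn_of_lift hγ hsmooth
  refine (Manifold.riemannianEDist_le_pathELength h1 rfl rfl hT.le).trans ?_
  rw [Manifold.pathELength_eq_lintegral_mfderivWithin_Icc]
  calc _ = ∫⁻ t in Icc 0 T, 1 := by
        refine setLIntegral_congr_fun measurableSet_Icc fun t ht => ?_
        refine (enorm_mfderivWithin f hT ht hγ (hc t ht)).trans ?_
        simp only [c, hspeed t ht, Real.sqrt_one, ENNReal.ofReal_one]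
    _ ≤ _ := by simp

/-- Every function `a x + G y` whose gradient has norm at most one is a lower bound for the length
of curves. -/
lemma calibration_le_pathELength (hT : 0 < T)
    (hγ : ∀ t ∈ Icc 0 T, c t ∈ strip ∧ γ t = stripProj b (c t)) (hc : ContDiffOn ℝ 1 c (Icc 0 T))
    {a : ℝ} {G g : ℝ → ℝ} (hG : ∀ y, HasDerivAt G (g y) y) (hg : Continuous g)
    (hag : ∀ y, a ^ 2 / f y + g y ^ 2 ≤ 1) :
    ENNReal.ofReal (a * ((c T).1 - (c 0).1) + (G (c T).2 - G (c 0).2)) ≤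
      Manifold.pathELength (𝓡∂ 2) γ 0 T := by
  have hGs : ContDiff ℝ 1 G := by
    rw [contDiff_one_iff_deriv]
    exact ⟨fun y => (hG y).differentiableAt, by rwa [funext fun y => (hG y).deriv]⟩
  let Φ : ℝ → ℝ := fun t => a * (c t).1 + G (c t).2
  have hΦ : ContDiffOn ℝ 1 Φ (Icc 0 T) :=
    (contDiffOn_const.mul (contDiff_fst.comp_contDiffOn hc)).add
      (hGs.comp_contDiffOn (contDiff_snd.comp_contDiffOn hc))
  have h1 : ENNReal.ofReal (a * ((c T).1 - (c 0).1) + (G (c T).2 - G (c 0).2)) ≤ ‖Φ T - Φ 0‖ₑ := by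
    rw [← ofReal_norm]
    refine ENNReal.ofReal_le_ofReal (le_trans (le_of_eq ?_) (le_abs_self _))
    simp only [Φ]
    ring
  refine h1.trans ((enorm_sub_le_lintegral_derivWithin_Icc_of_contDiffOn_Icc hΦ hT.le).trans ?_)
  rw [Manifold.pathELength_eq_lintegral_mfderivWithin_Icc]
  refine setLIntegral_mono' measurableSet_Icc fun t ht => ?_
  have hct := ((hc t ht).differentiableWithinAt one_ne_zero).hasDerivWithinAt
  set c' := derivWithin c (Icc 0 T) t
  refine le_of_le_of_eq ?_ (enorm_mfderivWithin f hT ht hγ hct).symm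
  have hx : HasDerivWithinAt (fun t => (c t).1) c'.1 (Icc 0 T) t :=
    (hasFDerivAt_fst (p := c t)).comp_hasDerivWithinAt t hct
  have hy : HasDerivWithinAt (fun t => (c t).2) c'.2 (Icc 0 T) t :=
    (hasFDerivAt_snd (p := c t)).comp_hasDerivWithinAt t hct
  have hΦd : HasDerivWithinAt Φ (a * c'.1 + g (c t).2 * c'.2) (Icc 0 T) t :=
    (hx.const_mul a).add ((hG _).comp_hasDerivWithinAt t hy)
  rw [hΦd.derivWithin (uniqueDiffOn_Icc hT t ht), ← ofReal_norm]
  refine ENNReal.ofReal_le_ofReal (Real.abs_le_sqrt ?_)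
  have hf := f.pos (c t).2
  have h2 := hag (c t).2
  -- Cauchy-Schwarz for the metric and the dual metric
  obtain ⟨A, rfl⟩ : ∃ A, a = A * f (c t).2 := ⟨a / f (c t).2, by field_simp⟩
  have h3 : (A * f (c t).2) ^ 2 / f (c t).2 = A ^ 2 * f (c t).2 := by field_simp
  rw [h3] at h2
  set F := f (c t).2
  have h4 : 0 ≤ F * (A * c'.2 - g (c t).2 * c'.1) ^ 2 := by positivity
  have h5 : 0 ≤ c'.2 ^ 2 + F * c'.1 ^ 2 := by positivity
  nlinarith [mul_le_mul_of_nonneg_right h2 h5]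

end

/-- A bound for the distance yields a point above the end point at which all calibrations satisfy
the bound. -/
lemma exists_lift_of_tau_lt {z : ℝ × ℝ} (hz : z ∈ strip) {q : StripQuotient b} {ρ : ℝ≥0∞}
    (h : (surface b f).tau (stripProj b z) q < ρ) :
    ∃ w ∈ strip, stripProj b w = q ∧ ∀ (a : ℝ) (G g : ℝ → ℝ), (∀ y, HasDerivAt G (g y) y) →
      Continuous g → (∀ y, a ^ 2 / f y + g y ^ 2 ≤ 1) →
      ENNReal.ofReal (a * (w.1 - z.1) + (G w.2 - G z.2)) ≤ ρ := by
  obtain ⟨γ, h0, h1, h2, h3⟩ := Manifold.exists_lt_of_riemannianEDist_lt h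
  obtain ⟨c, hc, hc0, hcγ⟩ := exists_lift (b := b) one_pos h2.continuousOn hz h0
  have h01 := hcγ 1 (right_mem_Icc.2 zero_le_one)
  refine ⟨c 1, h01.1, h01.2.symm.trans h1, fun a G g hG hg hag => ?_⟩
  have := calibration_le_pathELength f one_pos hcγ (contDiffOn_lift hcγ hc h2) hG hg hag
  rw [hc0] at this
  exact this.trans h3.le

end

section

open Topology Filter MeasureTheory

variable (f : Profile)

/-! ### Geodesics that cross the strip -/

/-- The normal speed at height `y` of a unit speed geodesic with Clairaut constant `c`. -/
def normalSpeed (c y : ℝ) : ℝ := √(1 - c ^ 2 / f y)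

variable {c : ℝ}

lemma one_sub_pos (hc : |c| < 1) (y : ℝ) : 0 < 1 - c ^ 2 / f y := by
  have h1 : c ^ 2 < 1 := (sq_lt_one_iff_abs_lt_one c).2 hc
  have h2 : c ^ 2 / f y ≤ c ^ 2 := div_le_self (sq_nonneg c) (f.one_le y)
  linarith

lemma normalSpeed_pos (hc : |c| < 1) (y : ℝ) : 0 < normalSpeed f c y :=
  Real.sqrt_pos.2 (one_sub_pos f hc y)

lemma normalSpeed_le_one (y : ℝ) : normalSpeed f c y ≤ 1 := by
  have := div_nonneg (sq_nonneg c) (f.pos y).le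
  exact Real.sqrt_le_iff.2 ⟨zero_le_one, by linarith⟩

lemma normalSpeed_sq (hc : |c| < 1) (y : ℝ) : normalSpeed f c y ^ 2 = 1 - c ^ 2 / f y :=
  Real.sq_sqrt (one_sub_pos f hc y).le

lemma contDiff_normalSpeed (hc : |c| < 1) {n : WithTop ℕ∞} : ContDiff ℝ n (normalSpeed f c) :=
  (contDiff_const.sub (contDiff_const.div (f.contDiff.of_le le_top) fun y => (f.pos y).ne')).sqrt
    fun y => (one_sub_pos f hc y).ne'

lemma continuous_normalSpeed (hc : |c| < 1) : Continuous (normalSpeed f c) :=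
  (contDiff_normalSpeed f hc (n := 0)).continuous

lemma Profile.continuous : Continuous f := (f.contDiff.of_le (m := 0) zero_le).continuous

lemma Profile.hasDerivAt (y : ℝ) : HasDerivAt f (deriv f y) y :=
  ((f.contDiff.of_le (m := 1) le_top).differentiable one_ne_zero y).hasDerivAt

/-- The time that a geodesic with Clairaut constant `c` takes to rise from height `0` to `Y`. -/
def riseTime (c Y : ℝ) : ℝ := ∫ y in 0..Y, 1 / normalSpeed f c y

/-- The tangential displacement of a geodesic with Clairaut constant `c` between the heights `0`
and `Y`. -/
def riseShift (c Y : ℝ) : ℝ := ∫ y in 0..Y, c / (f y * normalSpeed f c y)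

lemma continuous_riseTime_integrand (hc : |c| < 1) :
    Continuous fun y => 1 / normalSpeed f c y :=
  continuous_const.div (continuous_normalSpeed f hc) fun y => (normalSpeed_pos f hc y).ne'

lemma continuous_riseShift_integrand (hc : |c| < 1) :
    Continuous fun y => c / (f y * normalSpeed f c y) :=
  continuous_const.div (f.continuous.mul (continuous_normalSpeed f hc))
    fun y => (mul_pos (f.pos y) (normalSpeed_pos f hc y)).ne'

lemma hasDerivAt_riseTime (hc : |c| < 1) (Y : ℝ) :
    HasDerivAt (riseTime f c) (1 / normalSpeed f c Y) Y :=
  ((continuous_riseTime_integrand f hc).integral_hasStrictDerivAt 0 Y).hasDerivAt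

lemma hasDerivAt_riseShift (hc : |c| < 1) (Y : ℝ) :
    HasDerivAt (riseShift f c) (c / (f Y * normalSpeed f c Y)) Y :=
  ((continuous_riseShift_integrand f hc).integral_hasStrictDerivAt 0 Y).hasDerivAt

@[simp] lemma riseTime_zero : riseTime f c 0 = 0 := intervalIntegral.integral_same

@[simp] lemma riseShift_zero : riseShift f c 0 = 0 := intervalIntegral.integral_same

lemma strictMono_riseTime (hc : |c| < 1) : StrictMono (riseTime f c) :=
  strictMono_of_hasDerivAt_pos (hasDerivAt_riseTime f hc)
    fun y => one_div_pos.2 (normalSpeed_pos f hc y)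

lemma monotone_riseTime_sub (hc : |c| < 1) : Monotone fun Y => riseTime f c Y - Y :=
  monotone_of_hasDerivAt_nonneg (fun Y => (hasDerivAt_riseTime f hc Y).sub (hasDerivAt_id Y))
    fun y => sub_nonneg.2 ((one_le_div (normalSpeed_pos f hc y)).2 (normalSpeed_le_one f y))

lemma surjective_riseTime (hc : |c| < 1) : Function.Surjective (riseTime f c) := by
  intro t
  have hcont : Continuous (riseTime f c) :=
    continuous_iff_continuousAt.2 fun y => (hasDerivAt_riseTime f hc y).continuousAt
  refine mem_range_of_exists_le_of_exists_ge hcont ⟨min t 0, ?_⟩ ⟨max t 0, ?_⟩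
  · have := monotone_riseTime_sub f hc (min_le_right t 0)
    simp only [riseTime_zero] at this
    linarith [min_le_left t 0]
  · have := monotone_riseTime_sub f hc (le_max_right t 0)
    simp only [riseTime_zero] at this
    linarith [le_max_left t 0]

/-- The height at time `t` of the geodesic with Clairaut constant `c` that starts at height `0`. -/
def geodesicHeight (hc : |c| < 1) : ℝ ≃o ℝ :=
  ((strictMono_riseTime f hc).orderIsoOfSurjective _ (surjective_riseTime f hc)).symm

lemma riseTime_geodesicHeight (hc : |c| < 1) (t : ℝ) :
    riseTime f c (geodesicHeight f hc t) = t :=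
  ((strictMono_riseTime f hc).orderIsoOfSurjective _
    (surjective_riseTime f hc)).apply_symm_apply t

lemma geodesicHeight_riseTime (hc : |c| < 1) (y : ℝ) :
    geodesicHeight f hc (riseTime f c y) = y :=
  ((strictMono_riseTime f hc).orderIsoOfSurjective _
    (surjective_riseTime f hc)).symm_apply_apply y

lemma geodesicHeight_zero (hc : |c| < 1) : geodesicHeight f hc 0 = 0 := by
  simpa using geodesicHeight_riseTime f hc 0

lemma hasDerivAt_geodesicHeight (hc : |c| < 1) (t : ℝ) :
    HasDerivAt (geodesicHeight f hc) (normalSpeed f c (geodesicHeight f hc t)) t := by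
  have h := HasDerivAt.of_local_left_inverse (geodesicHeight f hc).continuous.continuousAt
    (hasDerivAt_riseTime f hc (geodesicHeight f hc t))
    (one_div_pos.2 (normalSpeed_pos f hc _)).ne'
    (Eventually.of_forall (riseTime_geodesicHeight f hc))
  simpa using h

/-- The tangential coordinate at time `t` of the geodesic with Clairaut constant `c` that starts at
the origin. -/
def geodesicShift (hc : |c| < 1) (t : ℝ) : ℝ := riseShift f c (geodesicHeight f hc t)

lemma hasDerivAt_geodesicShift (hc : |c| < 1) (t : ℝ) :
    HasDerivAt (geodesicShift f hc) (c / f (geodesicHeight f hc t)) t := by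
  have h := (hasDerivAt_riseShift f hc (geodesicHeight f hc t)).comp t
    (hasDerivAt_geodesicHeight f hc t)
  refine h.congr_deriv ?_
  have h1 := (normalSpeed_pos f hc (geodesicHeight f hc t)).ne'
  have h2 := (f.pos (geodesicHeight f hc t)).ne'
  field_simp

lemma contDiff_geodesicHeight (hc : |c| < 1) : ContDiff ℝ 2 (geodesicHeight f hc) := by
  have hd : deriv (geodesicHeight f hc) = fun t => normalSpeed f c (geodesicHeight f hc t) :=
    funext fun t => (hasDerivAt_geodesicHeight f hc t).deriv
  have hdiff : Differentiable ℝ (geodesicHeight f hc) :=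
    fun t => (hasDerivAt_geodesicHeight f hc t).differentiableAt
  have h1 : ContDiff ℝ 1 (geodesicHeight f hc) := by
    rw [contDiff_one_iff_deriv, hd]
    exact ⟨hdiff, (continuous_normalSpeed f hc).comp (geodesicHeight f hc).continuous⟩
  rw [show (2 : WithTop ℕ∞) = 1 + 1 by norm_num, contDiff_succ_iff_deriv, hd]
  exact ⟨hdiff, by simp, (contDiff_normalSpeed f hc).comp h1⟩

lemma contDiff_geodesicShift (hc : |c| < 1) : ContDiff ℝ 2 (geodesicShift f hc) := by
  have hd : deriv (geodesicShift f hc) = fun t => c / f (geodesicHeight f hc t) :=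
    funext fun t => (hasDerivAt_geodesicShift f hc t).deriv
  rw [show (2 : WithTop ℕ∞) = 1 + 1 by norm_num, contDiff_succ_iff_deriv, hd]
  refine ⟨fun t => (hasDerivAt_geodesicShift f hc t).differentiableAt, by simp, ?_⟩
  exact contDiff_const.div ((f.contDiff.of_le le_top).comp
    ((contDiff_geodesicHeight f hc).of_le (by norm_num))) fun t => (f.pos _).ne'

lemma hasDerivAt_normalSpeed (hc : |c| < 1) (y : ℝ) :
    HasDerivAt (normalSpeed f c) (c ^ 2 * deriv f y / (2 * f y ^ 2 * normalSpeed f c y)) y := by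
  have h1 : HasDerivAt (fun y => 1 - c ^ 2 / f y) (c ^ 2 * deriv f y / f y ^ 2) y := by
    refine (((hasDerivAt_const y (c ^ 2)).div (f.hasDerivAt y) (f.pos y).ne').const_sub 1
      ).congr_deriv ?_
    ring
  refine (h1.sqrt (one_sub_pos f hc y).ne').congr_deriv ?_
  rw [div_div]
  congr 1
  simp only [normalSpeed]
  ring

lemma hasDerivAt_geodesicHeight_deriv (hc : |c| < 1) (t : ℝ) :
    HasDerivAt (fun t => normalSpeed f c (geodesicHeight f hc t))
      (deriv f (geodesicHeight f hc t) / 2 * (c / f (geodesicHeight f hc t)) ^ 2) t := by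
  refine ((hasDerivAt_normalSpeed f hc _).comp t (hasDerivAt_geodesicHeight f hc t)).congr_deriv ?_
  have h1 := (normalSpeed_pos f hc (geodesicHeight f hc t)).ne'
  have h2 := (f.pos (geodesicHeight f hc t)).ne'
  field_simp

lemma hasDerivAt_geodesicShift_deriv (hc : |c| < 1) (t : ℝ) :
    HasDerivAt (fun t => c / f (geodesicHeight f hc t))
      (-(deriv f (geodesicHeight f hc t) / f (geodesicHeight f hc t) *
        normalSpeed f c (geodesicHeight f hc t) * (c / f (geodesicHeight f hc t)))) t := by
  have h2 := (f.pos (geodesicHeight f hc t)).ne'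
  refine ((hasDerivAt_const t c).div ((f.hasDerivAt _).comp t (hasDerivAt_geodesicHeight f hc t))
    h2).congr_deriv ?_
  simp only [Function.comp_apply]
  field_simp
  ring

lemma geodesic_speed (hc : |c| < 1) (y : ℝ) :
    normalSpeed f c y ^ 2 + f y * (c / f y) ^ 2 = 1 := by
  rw [normalSpeed_sq f hc]
  have := (f.pos y).ne'
  field_simp
  ring

/-- The crossing time of a geodesic is the value of the calibration that belongs to it. -/
lemma riseTime_eq_calibration (hc : |c| < 1) (Y : ℝ) :
    riseTime f c Y = c * riseShift f c Y + ∫ y in 0..Y, normalSpeed f c y := by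
  rw [riseTime, riseShift, ← intervalIntegral.integral_const_mul, ← intervalIntegral.integral_add]
  · refine intervalIntegral.integral_congr fun y _ => ?_
    have h1 := (normalSpeed_pos f hc y).ne'
    have h2 := (f.pos y).ne'
    have h3 := geodesic_speed f hc y
    field_simp
    field_simp at h3
    linarith
  · exact (continuous_const.mul (continuous_riseShift_integrand f hc)).intervalIntegrable _ _
  · exact (continuous_normalSpeed f hc).intervalIntegrable _ _

lemma riseTime_pos (hc : |c| < 1) {Y : ℝ} (hY : 0 < Y) : 0 < riseTime f c Y := by
  simpa using strictMono_riseTime f hc hY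

/-! ### The two profiles -/

/-- The warping function `2 - cos (k y)`. -/
def cosProfile (k : ℕ) : Profile where
  toFun y := 2 - Real.cos (k * y)
  contDiff := contDiff_const.sub (Real.contDiff_cos.comp (contDiff_const.mul contDiff_id))
  one_le y := by linarith [Real.cos_le_one (k * y)]
  symm y := by
    rw [mul_sub, Real.cos_nat_mul_two_pi_sub]
  zero := by norm_num

/-- The values of `2 - cos y` and `2 - cos 2y` are equally distributed on `[0, 2π]`. -/
lemma integral_cosProfile {F : ℝ → ℝ} (hF : Continuous fun y => F (cosProfile 1 y)) :
    ∫ y in 0..(2 * Real.pi), F (cosProfile 2 y) = ∫ y in 0..(2 * Real.pi), F (cosProfile 1 y) := by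
  have h1 : ∀ y, F (cosProfile 2 y) = F (cosProfile 1 (2 * y)) := fun y => by simp [cosProfile]
  have hper : Function.Periodic (fun y => F (cosProfile 1 y)) (2 * Real.pi) := fun y => by
    simp [cosProfile]
  simp only [h1]
  rw [intervalIntegral.integral_comp_mul_left (fun y => F (cosProfile 1 y)) two_ne_zero,
    ← intervalIntegral.integral_add_adjacent_intervals (b := 2 * Real.pi)
      (hF.intervalIntegrable _ _) (hF.intervalIntegrable _ _)]
  have h2 := hper.intervalIntegral_add_eq 0 (2 * Real.pi)
  rw [show 2 * (2 * Real.pi) = 2 * Real.pi + 2 * Real.pi by ring, ← h2, zero_add,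
    smul_eq_mul, mul_zero, ← two_mul, inv_mul_cancel_left₀ two_ne_zero]

lemma riseTime_cosProfile (hc : |c| < 1) :
    riseTime (cosProfile 2) c (2 * Real.pi) = riseTime (cosProfile 1) c (2 * Real.pi) :=
  integral_cosProfile (F := fun v => 1 / √(1 - c ^ 2 / v)) (continuous_riseTime_integrand _ hc)

lemma riseShift_cosProfile (hc : |c| < 1) :
    riseShift (cosProfile 2) c (2 * Real.pi) = riseShift (cosProfile 1) c (2 * Real.pi) :=
  integral_cosProfile (F := fun v => c / (v * √(1 - c ^ 2 / v)))
    (continuous_riseShift_integrand _ hc)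

lemma abs_clairaut_lt_one (s : ℝ) : |s / √(1 + s ^ 2)| < 1 := by
  have h : 0 < 1 + s ^ 2 := by positivity
  rw [abs_div, abs_of_pos (Real.sqrt_pos.2 h), div_lt_one (Real.sqrt_pos.2 h)]
  exact Real.lt_sqrt_of_sq_lt (by rw [sq_abs]; linarith)

lemma continuous_riseShift_clairaut :
    Continuous fun s : ℝ => riseShift f (s / √(1 + s ^ 2)) (2 * Real.pi) := by
  have hc : Continuous fun s : ℝ => s / √(1 + s ^ 2) :=
    continuous_id.div (by fun_prop) fun s => (Real.sqrt_pos.2 (by positivity)).ne'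
  refine intervalIntegral.continuous_parametric_intervalIntegral_of_continuous' ?_ _ _
  have hc' : Continuous fun p : ℝ × ℝ => p.1 / √(1 + p.1 ^ 2) := hc.comp continuous_fst
  have hf : Continuous fun p : ℝ × ℝ => f p.2 := f.continuous.comp continuous_snd
  refine hc'.div (hf.mul ?_)
    fun p => (mul_pos (f.pos _) (normalSpeed_pos f (abs_clairaut_lt_one p.1) p.2)).ne'
  exact (continuous_const.sub ((hc'.pow 2).div hf fun p => (f.pos _).ne')).sqrt

/-- The displacement of a crossing geodesic grows at least logarithmically as its direction
approaches that of the boundary, because `f - 1` vanishes to second order there. -/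
lemma log_le_riseShift {s : ℝ} (hs : 1 ≤ s) :
    Real.log s / 4 ≤ riseShift (cosProfile 1) (s / √(1 + s ^ 2)) (2 * Real.pi) := by
  have hs0 : 0 < 1 + s ^ 2 := by positivity
  set R := √(1 + s ^ 2) with hR
  have hRpos : 0 < R := Real.sqrt_pos.2 hs0
  have hRsq : R ^ 2 = 1 + s ^ 2 := Real.sq_sqrt hs0.le
  have hc := abs_clairaut_lt_one s
  rw [← hR] at hc
  set c := s / R with hcdef
  have hsR : s ≤ R := Real.le_sqrt_of_sq_le (by linarith)
  have hc2 : 1 / 2 ≤ c := by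
    rw [hcdef, le_div_iff₀ hRpos]
    nlinarith
  have hcsq : c ^ 2 = 1 - (1 / R) ^ 2 := by
    rw [hcdef, div_pow, div_pow, hRsq]
    field_simp
    ring
  have hε : 0 < 1 / R := by positivity
  set ε := 1 / R with hεdef
  have hpt : ∀ y ∈ Icc 0 (2 * Real.pi),
      1 / 4 * (y + ε)⁻¹ ≤ c / (cosProfile 1 y * normalSpeed (cosProfile 1) c y) := by
    intro y hy
    have hF : cosProfile 1 y = 2 - Real.cos y := by simp [cosProfile]
    have hFpos := (cosProfile 1).pos y
    have hv := normalSpeed_pos (cosProfile 1) hc y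
    -- since `ε² = 1 - c²`, the square of the denominator is at most `3 (y² / 2 + ε²)`
    have hle : cosProfile 1 y * normalSpeed (cosProfile 1) c y ≤ 2 * (y + ε) := by
      refine le_of_sq_le_sq ?_ (by linarith [hy.1])
      rw [mul_pow, normalSpeed_sq _ hc]
      have h1 : cosProfile 1 y ^ 2 * (1 - c ^ 2 / cosProfile 1 y) =
          cosProfile 1 y * (cosProfile 1 y - c ^ 2) := by
        field_simp
      rw [h1, hcsq]
      have h2 : cosProfile 1 y - 1 ≤ y ^ 2 / 2 := by
        rw [hF]
        linarith [Real.one_sub_sq_div_two_le_cos (x := y)]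
      have h3 : cosProfile 1 y ≤ 3 := by
        rw [hF]
        linarith [Real.neg_one_le_cos y]
      have h4 := (cosProfile 1).one_le y
      have h5 : 0 ≤ y * ε := mul_nonneg hy.1 hε.le
      nlinarith [sq_nonneg y, sq_nonneg ε]
    have hyε : 0 < y + ε := by linarith [hy.1]
    calc 1 / 4 * (y + ε)⁻¹ = (1 / 2) / (2 * (y + ε)) := by field_simp; norm_num
      _ ≤ _ := by gcongr
  have hint : ∫ y in 0..(2 * Real.pi), 1 / 4 * (y + ε)⁻¹ =
      1 / 4 * Real.log ((2 * Real.pi + ε) / ε) := by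
    rw [intervalIntegral.integral_const_mul,
      intervalIntegral.integral_comp_add_right (fun y => y⁻¹), zero_add,
      integral_inv_of_pos hε (by positivity)]
  have hlog : Real.log s ≤ Real.log ((2 * Real.pi + ε) / ε) := by
    refine Real.log_le_log (by linarith) ?_
    rw [hεdef, div_div_eq_mul_div, div_one, add_mul, one_div, inv_mul_cancel₀ hRpos.ne']
    nlinarith [Real.pi_gt_three]
  calc Real.log s / 4 ≤ 1 / 4 * Real.log ((2 * Real.pi + ε) / ε) := by linarith
    _ = _ := hint.symm
    _ ≤ _ := by
      refine intervalIntegral.integral_mono_on Real.two_pi_pos.le ?_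
        ((continuous_riseShift_integrand _ hc).intervalIntegrable _ _) hpt
      refine ContinuousOn.intervalIntegrable fun y hy => ContinuousAt.continuousWithinAt ?_
      rw [uIcc_of_le Real.two_pi_pos.le] at hy
      have : y + ε ≠ 0 := by linarith [hy.1]
      fun_prop (disch := assumption)

lemma riseShift_neg (Y : ℝ) : riseShift f (-c) Y = -riseShift f c Y := by
  rw [riseShift, riseShift, ← intervalIntegral.integral_neg]
  refine intervalIntegral.integral_congr fun y _ => ?_
  simp [normalSpeed, neg_div]

/-- Any tangential displacement is that of a crossing geodesic. -/
lemma exists_riseShift_eq (X : ℝ) :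
    ∃ c, |c| < 1 ∧ riseShift (cosProfile 1) c (2 * Real.pi) = X := by
  set s := Real.exp (4 * |X|)
  have hs : 1 ≤ s := Real.one_le_exp (by positivity)
  have h := log_le_riseShift hs
  rw [Real.log_exp] at h
  obtain ⟨t, ht⟩ := mem_range_of_exists_le_of_exists_ge (c := X)
    (continuous_riseShift_clairaut (cosProfile 1))
    ⟨-s, by
      rw [neg_sq, neg_div, riseShift_neg]
      linarith [neg_abs_le X]⟩
    ⟨s, by linarith [le_abs_self X]⟩
  exact ⟨_, abs_clairaut_lt_one t, ht⟩

end

section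

open Topology Filter MeasureTheory AnalyticRiemannianManifold

variable {b : Bool} (f : Profile) {c : ℝ}

/-! ### Distances between boundary points -/

lemma geodesicHeight_mem (hc : |c| < 1) {t : ℝ} (ht : t ∈ Icc 0 (riseTime f c (2 * Real.pi))) :
    geodesicHeight f hc t ∈ Icc 0 (2 * Real.pi) := by
  constructor
  · rw [← geodesicHeight_zero f hc]
    exact (geodesicHeight f hc).monotone ht.1
  · rw [← geodesicHeight_riseTime f hc (2 * Real.pi)]
    exact (geodesicHeight f hc).monotone ht.2

/-- The crossing geodesic bounds the distance of its end points. -/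
lemma tau_crossing_le (hc : |c| < 1) (r : Bool) (x : ℝ) :
    (surface b f).tau (stripProj b (x, flip r 0))
      (stripProj b (x + riseShift f c (2 * Real.pi), flip r (2 * Real.pi))) ≤
      ENNReal.ofReal (riseTime f c (2 * Real.pi)) := by
  have h := tau_le_of_unit_speed (b := b) f (riseTime_pos f hc Real.two_pi_pos).le
    (x := fun t => x + geodesicShift f hc t) (y := fun t => flip r (geodesicHeight f hc t))
    (fun t _ => ((hasDerivAt_geodesicShift f hc t).const_add x).hasDerivWithinAt)
    (fun t _ => ((hasDerivAt_flip r _).comp t (hasDerivAt_geodesicHeight f hc t)).hasDerivWithinAt)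
    (continuous_const.div (f.continuous.comp (geodesicHeight f hc).continuous)
      fun t => (f.pos _).ne').continuousOn
    (continuous_const.mul ((continuous_normalSpeed f hc).comp
      (geodesicHeight f hc).continuous)).continuousOn
    (fun t ht => ⟨mem_univ _, flip_mem r (geodesicHeight_mem f hc ht)⟩)
    (fun t _ => by
      rw [f.flip_apply, mul_pow, sq (flipSign r), flipSign_mul_self, one_mul]
      exact geodesic_speed f hc _)
  simpa [geodesicShift, geodesicHeight_zero, geodesicHeight_riseTime] using h

/-- A boundary component is a path of unit speed. -/
lemma tau_boundary_le {x x' y : ℝ} (hy : y = 0 ∨ y = 2 * Real.pi) :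
    (surface b f).tau (stripProj b (x, y)) (stripProj b (x', y)) ≤ ENNReal.ofReal |x' - x| := by
  obtain ⟨a, ha, ha'⟩ : ∃ a : ℝ, a ^ 2 = 1 ∧ a * |x' - x| = x' - x := by
    rcases abs_cases (x' - x) with h | h
    · exact ⟨1, by norm_num, by rw [h.1, one_mul]⟩
    · exact ⟨-1, by norm_num, by rw [h.1]; ring⟩
  have hmem : y ∈ Icc 0 (2 * Real.pi) := by
    have := Real.two_pi_pos.le
    rcases hy with rfl | rfl <;> constructor <;> linarith
  have hf : f y = 1 := by
    rcases hy with rfl | rfl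
    · exact f.zero
    · exact f.two_pi
  have h := tau_le_of_unit_speed (b := b) f (abs_nonneg (x' - x))
    (x := fun t => x + a * t) (y := fun _ => y) (x' := fun _ => a) (y' := fun _ => 0)
    (fun t _ => by
      simpa using (((hasDerivAt_id t).const_mul a).const_add x).hasDerivWithinAt)
    (fun t _ => hasDerivWithinAt_const _ _ _)
    continuousOn_const continuousOn_const (fun t _ => ⟨mem_univ _, hmem⟩)
    (fun t _ => by rw [hf, ha]; norm_num)
  simpa [ha'] using h

/-- Two profiles match if their crossing geodesics with the same Clairaut constant have the same
length and the same displacement. -/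
structure Profile.Matches (f g : Profile) : Prop where
  riseTime_eq : ∀ c, |c| < 1 → riseTime f c (2 * Real.pi) = riseTime g c (2 * Real.pi)
  riseShift_eq : ∀ c, |c| < 1 → riseShift f c (2 * Real.pi) = riseShift g c (2 * Real.pi)
  exists_riseShift : ∀ X, ∃ c, |c| < 1 ∧ riseShift f c (2 * Real.pi) = X

lemma matches_cosProfile : (cosProfile 1).Matches (cosProfile 2) where
  riseTime_eq _ hc := (riseTime_cosProfile hc).symm
  riseShift_eq _ hc := (riseShift_cosProfile hc).symm
  exists_riseShift := exists_riseShift_eq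

variable {f}

lemma Profile.Matches.symm {g : Profile} (h : f.Matches g) : g.Matches f where
  riseTime_eq c hc := (h.riseTime_eq c hc).symm
  riseShift_eq c hc := (h.riseShift_eq c hc).symm
  exists_riseShift X := by
    obtain ⟨c, hc, hX⟩ := h.exists_riseShift X
    exact ⟨c, hc, (h.riseShift_eq c hc).symm.trans hX⟩

/-- A curve that crosses the strip is at least as long as the crossing geodesic with the same
displacement, by the calibration of that geodesic. A curve with both ends on the same side is at
least as long as the segment of that side. -/
lemma Profile.Matches.tau_le {g : Profile} (h : f.Matches g) {p q : StripQuotient b}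
    (hp : p ∈ (surface b f).bdry) (hq : q ∈ (surface b f).bdry) :
    (surface b g).tau p q ≤ (surface b f).tau p q := by
  refine le_of_forall_gt fun ρ hρ => ?_
  obtain ⟨ρ', hρ', hρ''⟩ := exists_between hρ
  refine lt_of_le_of_lt ?_ hρ''
  obtain ⟨z, hz, rfl⟩ := exists_stripProj_eq p
  obtain ⟨w, hw, rfl, hcal⟩ := exists_lift_of_tau_lt f hz hρ'
  obtain ⟨x, y⟩ := z
  obtain ⟨x', y'⟩ := w
  have hy : y = 0 ∨ y = 2 * Real.pi := (mem_bdry_iff f hz rfl).1 hp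
  have hy' : y' = 0 ∨ y' = 2 * Real.pi := (mem_bdry_iff f hw rfl).1 hq
  have hsame : y = y' ∨ ∃ r, y = flip r 0 ∧ y' = flip r (2 * Real.pi) := by
    rcases hy with rfl | rfl <;> rcases hy' with rfl | rfl
    · exact Or.inl rfl
    · exact Or.inr ⟨false, rfl, rfl⟩
    · exact Or.inr ⟨true, by simp [flip], by simp [flip]⟩
    · exact Or.inl rfl
  rcases hsame with rfl | ⟨r, rfl, rfl⟩
  · refine (tau_boundary_le g hy).trans ?_
    have hcal' : ∀ a : ℝ, a ^ 2 = 1 → ENNReal.ofReal (a * (x' - x)) ≤ ρ' := fun a ha => by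
      simpa using hcal a (fun _ => 0) (fun _ => 0) (fun y => hasDerivAt_const y 0)
        continuous_const (fun y => by
          simpa [ha] using inv_le_one_of_one_le₀ (f.one_le y))
    rcases abs_cases (x' - x) with h | h
    · simpa [h.1] using hcal' 1 (by norm_num)
    · simpa [h.1] using hcal' (-1) (by norm_num)
  · obtain ⟨c, hc, hX⟩ := h.exists_riseShift (x' - x)
    have h1 := tau_crossing_le (b := b) g hc r x
    rw [← h.riseShift_eq c hc, hX, add_sub_cancel, ← h.riseTime_eq c hc] at h1
    refine h1.trans ?_
    have h2 := hcal c (fun y => flipSign r * ∫ v in 0..y, normalSpeed f c v)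
      (fun y => flipSign r * normalSpeed f c y)
      (fun y => ((continuous_normalSpeed f hc).integral_hasStrictDerivAt 0 y).hasDerivAt.const_mul _)
      (continuous_const.mul (continuous_normalSpeed f hc))
      (fun y => by
        rw [mul_pow, sq (flipSign r), flipSign_mul_self, normalSpeed_sq f hc]
        linarith)
    have h3 : flipSign r * (∫ v in 0..(flip r (2 * Real.pi)), normalSpeed f c v) -
        flipSign r * (∫ v in 0..(flip r 0), normalSpeed f c v) =
        ∫ v in 0..(2 * Real.pi), normalSpeed f c v := by
      cases r <;> simp [flip, flipSign]
    simp only [] at h2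
    rwa [h3, ← hX, ← riseTime_eq_calibration f hc] at h2

end

section

open Topology Filter AnalyticRiemannianManifold

variable {b : Bool} (f : Profile)

/-! ### The metric and the geodesic equation in coordinates -/

section

variable {e : OpenPartialHomeomorph (StripQuotient b) (EuclideanHalfSpace 2)}
  (he : e ∈ atlas (EuclideanHalfSpace 2) (StripQuotient b)) {u : EuclideanSpace ℝ (Fin 2)}
  (hu : u ∈ (e.extend (𝓡∂ 2)).target)
include he hu

lemma metricCoeff_eq (i j : Fin 2) :
    (surface b f).metricCoeff e u i j =
      diagForm (f (u 0)) (EuclideanSpace.single i 1) (EuclideanSpace.single j 1) := by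
  set q := (e.extend (𝓡∂ 2)).symm u with hq
  have hqs : q ∈ e.source := by
    rw [← e.extend_source (I := 𝓡∂ 2)]
    exact (e.extend (𝓡∂ 2)).map_target hu
  have heq : e.extend (𝓡∂ 2) q = u := (e.extend (𝓡∂ 2)).right_inv hu
  have hur : u ∈ range (𝓡∂ 2) := e.extend_target_subset_range hu
  obtain ⟨r, s, h1, h2⟩ := exists_transition he (chart_mem_atlas _ q) hqs (mem_chart_source _ q)
  rw [heq] at h1 h2
  have hd : HasMFDerivWithinAt 𝓘(ℝ, EuclideanSpace ℝ (Fin 2)) (𝓡∂ 2) (e.extend (𝓡∂ 2)).symm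
      (range (𝓡∂ 2)) u (transitionDeriv r) := by
    refine ⟨?_, ?_⟩
    · rw [← heq]
      exact (e.continuousAt_extend_symm hqs).continuousWithinAt
    · simp only [mfld_simps]
      exact (hasFDerivAt_transition r s u).hasFDerivWithinAt.congr_of_eventuallyEq h2 h1
  have hd' := hd.mfderivWithin ((𝓡∂ 2).uniqueDiffOn.uniqueMDiffOn u hur)
  refine (congrArg (fun L : EuclideanSpace ℝ (Fin 2) →L[ℝ] EuclideanSpace ℝ (Fin 2) =>
    diagForm (f (height q)) (L (EuclideanSpace.single i 1)) (L (EuclideanSpace.single j 1)))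
    hd').trans ?_
  refine (diagForm_transitionDeriv _ _ _ _).trans ?_
  rw [← warp_chart_eq_height f he hqs, heq]

lemma metricPartial_eq (l i j : Fin 2) :
    (surface b f).metricPartial e u l i j =
      deriv f (u 0) * (EuclideanSpace.single l (1 : ℝ) : EuclideanSpace ℝ (Fin 2)) 0 *
        ((EuclideanSpace.single i (1 : ℝ) : EuclideanSpace ℝ (Fin 2)) 1 *
          (EuclideanSpace.single j (1 : ℝ) : EuclideanSpace ℝ (Fin 2)) 1) := by
  have hur : u ∈ range (𝓡∂ 2) := e.extend_target_subset_range hu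
  have hev : ∀ᶠ w in 𝓝[range (𝓡∂ 2)] u, (surface b f).metricCoeff e w i j =
      diagForm (f (w 0)) (EuclideanSpace.single i 1) (EuclideanSpace.single j 1) := by
    have hqs : (e.extend (𝓡∂ 2)).symm u ∈ e.source := by
      rw [← e.extend_source (I := 𝓡∂ 2)]
      exact (e.extend (𝓡∂ 2)).map_target hu
    have := e.extend_target_mem_nhdsWithin (I := 𝓡∂ 2) hqs
    rw [(e.extend (𝓡∂ 2)).right_inv hu] at this
    filter_upwards [this] with w hw using metricCoeff_eq f he hw i j
  have h0 : HasFDerivAt (fun w : EuclideanSpace ℝ (Fin 2) => w 0)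
      (EuclideanSpace.proj 0 : EuclideanSpace ℝ (Fin 2) →L[ℝ] ℝ) u :=
    (EuclideanSpace.proj 0 : EuclideanSpace ℝ (Fin 2) →L[ℝ] ℝ).hasFDerivAt
  have h1 := ((((f.hasDerivAt (u 0)).comp_hasFDerivAt u h0).mul_const
    ((EuclideanSpace.single i (1 : ℝ) : EuclideanSpace ℝ (Fin 2)) 1 *
      (EuclideanSpace.single j (1 : ℝ) : EuclideanSpace ℝ (Fin 2)) 1)).const_add
    ((EuclideanSpace.single i (1 : ℝ) : EuclideanSpace ℝ (Fin 2)) 0 *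
      (EuclideanSpace.single j (1 : ℝ) : EuclideanSpace ℝ (Fin 2)) 0)).hasFDerivWithinAt
        (s := range (𝓡∂ 2))
  have h2 := (h1.congr_of_eventuallyEq
    (f₁ := fun w => (surface b f).metricCoeff e w i j)
    (hev.mono fun w hw => by simpa using hw)
    (by simpa using hev.self_of_nhdsWithin hur)).fderivWithin ((𝓡∂ 2).uniqueDiffOn u hur)
  refine (congrArg (fun L => L (EuclideanSpace.single l (1 : ℝ))) h2).trans ?_
  change _ * (_ * (EuclideanSpace.single l (1 : ℝ) : EuclideanSpace ℝ (Fin 2)) 0) = _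
  ring

lemma metricCoeff_inv :
    ((Matrix.of ((surface b f).metricCoeff e u))⁻¹ : Matrix (Fin 2) (Fin 2) ℝ) =
      !![1, 0; 0, 1 / f (u 0)] := by
  apply Matrix.inv_eq_right_inv
  have hf := (f.pos (u 0)).ne'
  ext i j
  fin_cases i <;> fin_cases j <;>
    simp [Matrix.mul_apply, metricCoeff_eq f he hu, hf]

lemma sum_christoffel_zero (v : Fin 2 → ℝ) :
    ∑ i, ∑ j, (surface b f).christoffel e u 0 i j * v i * v j =
      -(deriv f (u 0) / 2 * v 1 ^ 2) := by
  simp [christoffel, Fin.sum_univ_two, metricCoeff_inv f he hu, metricPartial_eq f he hu]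
  ring

lemma sum_christoffel_one (v : Fin 2 → ℝ) :
    ∑ i, ∑ j, (surface b f).christoffel e u 1 i j * v i * v j =
      deriv f (u 0) / f (u 0) * (v 0 * v 1) := by
  have hf := (f.pos (u 0)).ne'
  simp [christoffel, Fin.sum_univ_two, metricCoeff_inv f he hu, metricPartial_eq f he hu]
  field_simp
  ring

end

lemma deriv_flip_apply (r : Bool) (y : ℝ) : deriv f (flip r y) = flipSign r * deriv f y := by
  have h : HasDerivAt (fun y => f (flip r y)) (deriv f (flip r y) * flipSign r) y :=
    (f.hasDerivAt _).comp y (hasDerivAt_flip r y)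
  simp only [f.flip_apply] at h
  rw [h.deriv, mul_left_comm, flipSign_mul_self, mul_one]

/-- The geodesic equation in terms of a lift `(x, y)` to the strip. -/
lemma geodesic_equation_iff {T t : ℝ} (hT : 0 < T) (ht : t ∈ Icc 0 T) {γ : ℝ → surface b f}
    {x y : ℝ → ℝ} (hγ : ∀ t ∈ Icc 0 T, (x t, y t) ∈ strip ∧ γ t = stripProj b (x t, y t))
    (hx : ContDiffOn ℝ 2 x (Icc 0 T)) (hy : ContDiffOn ℝ 2 y (Icc 0 T)) :
    (∀ k : Fin 2,
      let φ := chartAt (EuclideanHalfSpace 2) (γ t)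
      let c : ℝ → EuclideanSpace ℝ (Fin 2) := fun s => φ.extend (𝓡∂ 2) (γ s)
      iteratedDerivWithin 2 (fun s => c s k) (Icc 0 T) t +
        ∑ i, ∑ j, (surface b f).christoffel φ (c t) k i j *
          derivWithin (fun s => c s i) (Icc 0 T) t *
            derivWithin (fun s => c s j) (Icc 0 T) t = 0) ↔
    iteratedDerivWithin 2 y (Icc 0 T) t =
        deriv f (y t) / 2 * derivWithin x (Icc 0 T) t ^ 2 ∧
      iteratedDerivWithin 2 x (Icc 0 T) t =
        -(deriv f (y t) / f (y t) * (derivWithin y (Icc 0 T) t * derivWithin x (Icc 0 T) t)) := by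
  have hu := uniqueDiffOn_Icc hT
  have hc : ContinuousWithinAt (fun t => (x t, y t)) (Icc 0 T) t :=
    (hx.continuousOn t ht).prodMk (hy.continuousOn t ht)
  obtain ⟨r, a, -, h⟩ := exists_extChartAt_eq (hγ t ht).1 (hγ t ht).2
  have hev := eventually_extChartAt_eq (γ := γ) hγ hc h
  have hself := hev.self_of_nhdsWithin ht
  set φ := chartAt (EuclideanHalfSpace 2) (γ t) with hφ
  have hφa : φ ∈ atlas (EuclideanHalfSpace 2) (StripQuotient b) := chart_mem_atlas _ _
  have htar : φ.extend (𝓡∂ 2) (γ t) ∈ (φ.extend (𝓡∂ 2)).target :=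
    (φ.extend (𝓡∂ 2)).map_source (by
      rw [φ.extend_source]
      exact mem_chart_source _ _)
  have e0 : (fun s => φ.extend (𝓡∂ 2) (γ s) 0) =ᶠ[𝓝[Icc 0 T] t]
      fun s => flip r 0 + flipSign r * y s := hev.mono fun s hs => by
    refine (congrArg (fun v : EuclideanSpace ℝ (Fin 2) => v 0) hs).trans ?_
    rw [coord_zero, flip_eq]
  have e1 : (fun s => φ.extend (𝓡∂ 2) (γ s) 1) =ᶠ[𝓝[Icc 0 T] t] fun s => a + x s :=
    hev.mono fun s hs => by
      refine (congrArg (fun v : EuclideanSpace ℝ (Fin 2) => v 1) hs).trans ?_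
      rw [coord_one, add_comm]
  have d0 : derivWithin (fun s => φ.extend (𝓡∂ 2) (γ s) 0) (Icc 0 T) t =
      flipSign r * derivWithin y (Icc 0 T) t := by
    rw [e0.derivWithin_eq (e0.self_of_nhdsWithin ht), derivWithin_const_add,
      derivWithin_const_mul _ (hy.differentiableOn two_ne_zero t ht)]
  have d1 : derivWithin (fun s => φ.extend (𝓡∂ 2) (γ s) 1) (Icc 0 T) t =
      derivWithin x (Icc 0 T) t := by
    rw [e1.derivWithin_eq (e1.self_of_nhdsWithin ht), derivWithin_const_add]
  have i0 : iteratedDerivWithin 2 (fun s => φ.extend (𝓡∂ 2) (γ s) 0) (Icc 0 T) t =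
      flipSign r * iteratedDerivWithin 2 y (Icc 0 T) t := by
    rw [e0.iteratedDerivWithin_eq (e0.self_of_nhdsWithin ht),
      iteratedDerivWithin_const_add two_pos, iteratedDerivWithin_const_mul_field]
  have i1 : iteratedDerivWithin 2 (fun s => φ.extend (𝓡∂ 2) (γ s) 1) (Icc 0 T) t =
      iteratedDerivWithin 2 x (Icc 0 T) t := by
    rw [e1.iteratedDerivWithin_eq (e1.self_of_nhdsWithin ht), iteratedDerivWithin_const_add two_pos]
  have hu0 : φ.extend (𝓡∂ 2) (γ t) 0 = flip r (y t) :=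
    congrArg (fun v : EuclideanSpace ℝ (Fin 2) => v 0) hself
  have hsq := flipSign_mul_self r
  have hs0 : flipSign r ≠ 0 := left_ne_zero_of_mul_eq_one hsq
  let v : Fin 2 → ℝ := fun i => derivWithin (fun s => φ.extend (𝓡∂ 2) (γ s) i) (Icc 0 T) t
  have hv0 : v 0 = flipSign r * derivWithin y (Icc 0 T) t := d0
  have hv1 : v 1 = derivWithin x (Icc 0 T) t := d1
  rw [Fin.forall_fin_two]
  refine and_congr ?_ ?_
  · refine (Eq.congr_left (congrArg₂ (· + ·) i0 (sum_christoffel_zero f hφa htar v))).trans ?_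
    dsimp only
    rw [hv1, hu0, deriv_flip_apply]
    constructor
    · intro h
      refine mul_left_cancel₀ hs0 ?_
      linarith
    · intro h
      rw [h]
      ring
  · refine (Eq.congr_left (congrArg₂ (· + ·) i1 (sum_christoffel_one f hφa htar v))).trans ?_
    dsimp only
    rw [hv0, hv1, hu0, deriv_flip_apply, f.flip_apply, ← add_eq_zero_iff_eq_neg]
    have : flipSign r * deriv f (y t) / f (y t) * (flipSign r * derivWithin y (Icc 0 T) t *
        derivWithin x (Icc 0 T) t) = flipSign r * flipSign r * (deriv f (y t) / f (y t) *
          (derivWithin y (Icc 0 T) t * derivWithin x (Icc 0 T) t)) := by ring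
    rw [this, hsq, one_mul]

end

section

open Topology Filter AnalyticRiemannianManifold

variable {b : Bool} (f : Profile)

/-! ### Lens data -/

lemma pointsInwards_iff (q : surface b f) (v : EuclideanSpace ℝ (Fin 2)) :
    (surface b f).PointsInwards q v ↔ 0 < v 0 := by
  have hf := f.pos (height q)
  have hin : ∀ v w : EuclideanSpace ℝ (Fin 2), (surface b f).metric.inner q v w =
      v 0 * w 0 + f (height q) * (v 1 * w 1) := diagForm_apply _
  constructor
  · rintro ⟨(ν : EuclideanSpace ℝ (Fin 2)), ⟨-, h2, h3⟩, h4⟩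
    have h5 := h2 (EuclideanSpace.single 1 (1 : ℝ) : EuclideanSpace ℝ (Fin 2))
      (by simp [IsTangentToBdry, normalCoord])
    change 0 < ν 0 at h3
    rw [hin] at h4 h5
    simp at h5
    rw [h5.resolve_left hf.ne'] at h4
    exact (pos_iff_pos_of_mul_pos (by simpa using h4)).2 h3
  · intro hv
    refine ⟨(EuclideanSpace.single 0 (1 : ℝ) : EuclideanSpace ℝ (Fin 2)), ⟨?_, ?_, ?_⟩, ?_⟩
    · rw [hin]
      simp
    · intro (w : EuclideanSpace ℝ (Fin 2)) hw
      change w 0 = 0 at hw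
      rw [hin, hw]
      simp
    · simp [normalCoord]
    · rw [hin]
      simpa using hv

lemma isBdryProjection_iff (q : surface b f) (v u : EuclideanSpace ℝ (Fin 2)) :
    (surface b f).IsBdryProjection q v u ↔ u = !₂[0, v 1] := by
  have hf := f.pos (height q)
  have hin : ∀ v w : EuclideanSpace ℝ (Fin 2), (surface b f).metric.inner q v w =
      v 0 * w 0 + f (height q) * (v 1 * w 1) := diagForm_apply _
  constructor
  · rintro ⟨h1, h2⟩
    change u 0 = 0 at h1
    have h3 := h2 (EuclideanSpace.single 1 (1 : ℝ) : EuclideanSpace ℝ (Fin 2))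
      (by simp [IsTangentToBdry, normalCoord])
    have h4 := (hin (v - u) (EuclideanSpace.single 1 (1 : ℝ))).symm.trans h3
    simp [hf.ne', sub_eq_zero] at h4
    ext i
    fin_cases i
    · simpa using h1
    · simpa using h4.symm
  · rintro rfl
    refine ⟨by simp [IsTangentToBdry, normalCoord], fun (w : EuclideanSpace ℝ (Fin 2)) hw => ?_⟩
    change w 0 = 0 at hw
    refine (hin (v - !₂[0, v 1]) w).trans ?_
    rw [hw]
    simp

/-- The tangent vector with given coordinates in the preferred chart at its base point. -/
def tangentVec (q : StripQuotient b) (v : EuclideanSpace ℝ (Fin 2)) :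
    TangentBundle (𝓡∂ 2) (StripQuotient b) :=
  ⟨q, v⟩

/-- The lens datum of the geodesic with Clairaut constant `c` that enters the strip at the point
with tangential coordinate `x`, from the side `y = 0` if `r` is false and from the side `y = 2π`
if `r` is true. -/
def crossingData (b : Bool) (f : Profile) (c : ℝ) (r : Bool) (x : ℝ) :
    TangentBundle (𝓡∂ 2) (StripQuotient b) × TangentBundle (𝓡∂ 2) (StripQuotient b) × ℝ :=
  (tangentVec (stripProj b (x, flip r 0)) !₂[0, c],
    tangentVec (stripProj b (x + riseShift f c (2 * Real.pi), flip r (2 * Real.pi))) !₂[0, c],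
    riseTime f c (2 * Real.pi))

/-- The preferred chart at a point of the side `y = flip r 0` measures the height from that side. -/
lemma eq_of_flip_flip_zero_lt {r r' : Bool} (h : flip r' (flip r 0) < 2 * Real.pi) : r' = r := by
  cases r <;> cases r' <;> simp [flip] at h ⊢

lemma flip_eq_zero_or_iff (r : Bool) (y : ℝ) :
    (flip r y = 0 ∨ flip r y = 2 * Real.pi) ↔ (y = 0 ∨ y = 2 * Real.pi) := by
  cases r
  · rfl
  · simp only [flip, if_true, sub_eq_zero, sub_eq_self]
    rw [or_comm, eq_comm (a := 2 * Real.pi)]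

lemma hasDerivWithinAt_derivWithin {x : ℝ → ℝ} {T t : ℝ} (hT : 0 < T)
    (hx : ContDiffOn ℝ 2 x (Icc 0 T)) (ht : t ∈ Icc 0 T) :
    HasDerivWithinAt (derivWithin x (Icc 0 T)) (iteratedDerivWithin 2 x (Icc 0 T) t)
      (Icc 0 T) t := by
  have h1 := (contDiffOn_succ_iff_derivWithin (n := 1) (uniqueDiffOn_Icc hT)).1
    (by norm_num; exact hx)
  have h2 := (h1.2.2.differentiableOn one_ne_zero t ht).hasDerivWithinAt
  rwa [iteratedDerivWithin_succ, iteratedDerivWithin_one]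

lemma iteratedDerivWithin_two_eq {x x' : ℝ → ℝ} {x'' T t : ℝ} (hT : 0 < T) (ht : t ∈ Icc 0 T)
    (hx : ∀ t, HasDerivAt x (x' t) t) (hx' : HasDerivAt x' x'' t) :
    iteratedDerivWithin 2 x (Icc 0 T) t = x'' := by
  have hu := uniqueDiffOn_Icc hT
  have h : ∀ s ∈ Icc 0 T, iteratedDerivWithin 1 x (Icc 0 T) s = x' s := fun s hs => by
    rw [iteratedDerivWithin_one]
    exact (hx s).hasDerivWithinAt.derivWithin (hu s hs)
  rw [iteratedDerivWithin_succ, derivWithin_congr h (h t ht)]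
  exact hx'.hasDerivWithinAt.derivWithin (hu t ht)

lemma eq_of_hasDerivWithinAt_zero {g : ℝ → ℝ} {T : ℝ} (hT : 0 < T)
    (hg : ∀ t ∈ Icc 0 T, HasDerivWithinAt g 0 (Icc 0 T) t) {t : ℝ} (ht : t ∈ Icc 0 T) :
    g t = g 0 :=
  constant_of_derivWithin_zero (fun t ht => (hg t ht).differentiableWithinAt)
    (fun t ht => (hg t (Ico_subset_Icc_self ht)).derivWithin
      (uniqueDiffOn_Icc hT t (Ico_subset_Icc_self ht))) t ht

section

variable {T : ℝ} {γ : ℝ → surface b f} {x y : ℝ → ℝ}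

/-- Clairaut's relation. -/
lemma IsUnitGeodesic.clairaut (hT : 0 < T) (hg : (surface b f).IsUnitGeodesic γ T)
    (hγ : ∀ t ∈ Icc 0 T, (x t, y t) ∈ strip ∧ γ t = stripProj b (x t, y t))
    (hx : ContDiffOn ℝ 2 x (Icc 0 T)) (hy : ContDiffOn ℝ 2 y (Icc 0 T)) {t : ℝ}
    (ht : t ∈ Icc 0 T) :
    f (y t) * derivWithin x (Icc 0 T) t = f (y 0) * derivWithin x (Icc 0 T) 0 := by
  refine eq_of_hasDerivWithinAt_zero hT (g := fun t => f (y t) * derivWithin x (Icc 0 T) t)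
    (fun t ht => ?_) ht
  have h1 := ((geodesic_equation_iff f hT ht hγ hx hy).1 (hg.geodesic_equation t ht)).2
  have h2 := (f.hasDerivAt (y t)).comp_hasDerivWithinAt t
    (hy.differentiableOn two_ne_zero t ht).hasDerivWithinAt
  refine (h2.mul (hasDerivWithinAt_derivWithin hT hx ht)).congr_deriv ?_
  rw [h1]
  have := (f.pos (y t)).ne'
  simp only [Function.comp_apply]
  field_simp
  ring

lemma IsUnitGeodesic.speed (hT : 0 < T) (hg : (surface b f).IsUnitGeodesic γ T)
    (hγ : ∀ t ∈ Icc 0 T, (x t, y t) ∈ strip ∧ γ t = stripProj b (x t, y t))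
    (hx : ContDiffOn ℝ 2 x (Icc 0 T)) (hy : ContDiffOn ℝ 2 y (Icc 0 T)) {t : ℝ}
    (ht : t ∈ Icc 0 T) :
    derivWithin y (Icc 0 T) t ^ 2 + f (y t) * derivWithin x (Icc 0 T) t ^ 2 = 1 := by
  have h := inner_velocity f hT ht (c := fun t => (x t, y t)) hγ
    ((hx.differentiableOn two_ne_zero t ht).hasDerivWithinAt.prodMk
      (hy.differentiableOn two_ne_zero t ht).hasDerivWithinAt)
  exact h.symm.trans (hg.unit_speed t ht)

/-- A geodesic that enters the strip rises monotonically, with the normal speed prescribed by its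
Clairaut constant. -/
lemma IsUnitGeodesic.rise (hT : 0 < T) (hg : (surface b f).IsUnitGeodesic γ T)
    (hγ : ∀ t ∈ Icc 0 T, (x t, y t) ∈ strip ∧ γ t = stripProj b (x t, y t))
    (hx : ContDiffOn ℝ 2 x (Icc 0 T)) (hy : ContDiffOn ℝ 2 y (Icc 0 T)) {r : Bool}
    (h0 : y 0 = flip r 0) (hin : 0 < flipSign r * derivWithin y (Icc 0 T) 0) {c : ℝ}
    (hxc : derivWithin x (Icc 0 T) 0 = c) :
    |c| < 1 ∧ (∀ t ∈ Icc 0 T, derivWithin x (Icc 0 T) t = c / f (y t)) ∧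
      ∀ t ∈ Icc 0 T, riseTime f c (flip r (y t)) = t ∧
        x t = x 0 + riseShift f c (flip r (y t)) := by
  have h0T : (0 : ℝ) ∈ Icc 0 T := left_mem_Icc.2 hT.le
  have hf0 : f (y 0) = 1 := by rw [h0, f.flip_apply, f.zero]
  have hsq := flipSign_mul_self r
  have hcl : ∀ t ∈ Icc 0 T, derivWithin x (Icc 0 T) t = c / f (y t) := fun t ht => by
    have h := IsUnitGeodesic.clairaut f hT hg hγ hx hy ht
    rw [hf0, one_mul, hxc] at h
    rw [eq_div_iff (f.pos _).ne', ← h, mul_comm]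
  have hc : |c| < 1 := by
    have h := IsUnitGeodesic.speed f hT hg hγ hx hy h0T
    rw [hf0, hxc, one_mul] at h
    have h1 : derivWithin y (Icc 0 T) 0 ≠ 0 := right_ne_zero_of_mul hin.ne'
    have := sq_pos_of_ne_zero h1
    exact (sq_lt_one_iff_abs_lt_one c).1 (by linarith)
  have hY : ContinuousOn (fun t => flipSign r * derivWithin y (Icc 0 T) t) (Icc 0 T) :=
    continuousOn_const.mul fun t ht => (hasDerivWithinAt_derivWithin hT hy ht).continuousWithinAt
  have hYsq : ∀ t ∈ Icc 0 T, (flipSign r * derivWithin y (Icc 0 T) t) ^ 2 = 1 - c ^ 2 / f (y t) :=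
    fun t ht => by
      have h := IsUnitGeodesic.speed f hT hg hγ hx hy ht
      have h1 : f (y t) * (c / f (y t)) ^ 2 = c ^ 2 / f (y t) := by
        have := (f.pos (y t)).ne'
        field_simp
      rw [hcl t ht, h1] at h
      linear_combination h + derivWithin y (Icc 0 T) t ^ 2 * hsq
  -- `y'` never vanishes, so it keeps its initial sign
  have hYpos : ∀ t ∈ Icc 0 T, 0 < flipSign r * derivWithin y (Icc 0 T) t := by
    intro t ht
    by_contra! hcon
    obtain ⟨s, hs, hs0⟩ := isPreconnected_Icc.intermediate_value ht h0T hY ⟨hcon, hin.le⟩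
    have h := hYsq s hs
    dsimp only at hs0
    rw [hs0] at h
    have := one_sub_pos f hc (y s)
    norm_num at h
    linarith
  have hYeq : ∀ t ∈ Icc 0 T,
      flipSign r * derivWithin y (Icc 0 T) t = normalSpeed f c (flip r (y t)) := fun t ht => by
    rw [normalSpeed, f.flip_apply, ← hYsq t ht, Real.sqrt_sq (hYpos t ht).le]
  have hη : ∀ t ∈ Icc 0 T, HasDerivWithinAt (fun t => flip r (y t))
      (normalSpeed f c (flip r (y t))) (Icc 0 T) t := fun t ht => by
    rw [← hYeq t ht]
    exact (hasDerivAt_flip r (y t)).comp_hasDerivWithinAt t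
      (hy.differentiableOn two_ne_zero t ht).hasDerivWithinAt
  have hη0 : flip r (y 0) = 0 := by rw [h0, flip_flip]
  refine ⟨hc, hcl, fun t ht => ⟨?_, ?_⟩⟩
  · have h := eq_of_hasDerivWithinAt_zero hT
      (g := fun t => riseTime f c (flip r (y t)) - t) (fun t ht => ?_) ht
    · rw [hη0, riseTime_zero] at h
      linarith
    · refine (((hasDerivAt_riseTime f hc _).comp_hasDerivWithinAt t (hη t ht)).sub
        (hasDerivWithinAt_id t _)).congr_deriv ?_
      rw [one_div_mul_cancel (normalSpeed_pos f hc _).ne', sub_self]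
  · have h := eq_of_hasDerivWithinAt_zero hT
      (g := fun t => x t - riseShift f c (flip r (y t))) (fun t ht => ?_) ht
    · rw [hη0, riseShift_zero] at h
      linarith
    · refine ((hx.differentiableOn two_ne_zero t ht).hasDerivWithinAt.sub
        ((hasDerivAt_riseShift f hc _).comp_hasDerivWithinAt t (hη t ht))).congr_deriv ?_
      rw [hcl t ht, f.flip_apply]
      have h1 := (normalSpeed_pos f hc (flip r (y t))).ne'
      have h2 := (f.pos (y t)).ne'
      field_simp
      ring

end

/-- A geodesic that enters the strip leaves it on the opposite side, and is determined by its
Clairaut constant and its starting point. -/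
lemma exists_crossingData_of_mem_exitData
    {d : TangentBundle (𝓡∂ 2) (surface b f) × TangentBundle (𝓡∂ 2) (surface b f) × ℝ}
    (hd : d ∈ (surface b f).exitData) :
    ∃ c, |c| < 1 ∧ ∃ r x, d = crossingData b f c r x := by
  obtain ⟨γ, T, u₀, u₁, hT, hg, hb0, hbT, -, hin, hu0, hu1, rfl⟩ := hd
  have h0T : (0 : ℝ) ∈ Icc 0 T := left_mem_Icc.2 hT.le
  have hTT : T ∈ Icc 0 T := right_mem_Icc.2 hT.le
  obtain ⟨z, hz, hz0⟩ := exists_stripProj_eq (b := b) (γ 0)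
  obtain ⟨p, hpc, hp0, hγ'⟩ := exists_lift (b := b) hT hg.contMDiffOn.continuousOn hz hz0.symm
  have hp2 := contDiffOn_lift hγ' hpc hg.contMDiffOn
  obtain ⟨x, y, rfl⟩ : ∃ x y : ℝ → ℝ, p = fun t => (x t, y t) :=
    ⟨fun t => (p t).1, fun t => (p t).2, rfl⟩
  have hγ : ∀ t ∈ Icc 0 T, (x t, y t) ∈ strip ∧ γ t = stripProj b (x t, y t) := hγ'
  have hx : ContDiffOn ℝ 2 x (Icc 0 T) := contDiff_fst.comp_contDiffOn hp2
  have hy : ContDiffOn ℝ 2 y (Icc 0 T) := contDiff_snd.comp_contDiffOn hp2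
  obtain ⟨r, hr⟩ : ∃ r, y 0 = flip r 0 := by
    rcases (mem_bdry_iff f (hγ 0 h0T).1 (hγ 0 h0T).2).1 hb0 with h | h
    · exact ⟨false, h⟩
    · exact ⟨true, by rw [show y 0 = 2 * Real.pi from h]; simp [flip]⟩
  have hvel : ∀ t ∈ Icc 0 T, ∃ r', flip r' (y t) < 2 * Real.pi ∧ (surface b f).velocity γ T t =
      coordDeriv r' (derivWithin x (Icc 0 T) t, derivWithin y (Icc 0 T) t) := fun t ht => by
    obtain ⟨r', a, h1, h⟩ := exists_extChartAt_eq (hγ t ht).1 (hγ t ht).2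
    exact ⟨r', h1, exists_velocity_eq f hT ht (c := fun t => (x t, y t)) hγ
      ((hx.differentiableOn two_ne_zero t ht).hasDerivWithinAt.prodMk
        (hy.differentiableOn two_ne_zero t ht).hasDerivWithinAt) h⟩
  obtain ⟨r0, hr0, hv0⟩ := hvel 0 h0T
  obtain ⟨rT, -, hvT⟩ := hvel T hTT
  rw [hr] at hr0
  obtain rfl := eq_of_flip_flip_zero_lt hr0
  rw [hv0] at hin hu0
  rw [hvT] at hu1
  replace hin := (pointsInwards_iff f _ _).1 hin
  replace hu0 := (isBdryProjection_iff f _ _ _).1 hu0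
  replace hu1 := (isBdryProjection_iff f _ _ _).1 hu1
  simp only [coordDeriv_zero, coordDeriv_one] at hin hu0 hu1
  obtain ⟨hc, hcl, hrise⟩ := IsUnitGeodesic.rise f hT hg hγ hx hy hr hin rfl
  set c := derivWithin x (Icc 0 T) 0
  obtain ⟨hRT, hxT⟩ := hrise T hTT
  have hend : flip r0 (y T) = 2 * Real.pi := by
    have h := (mem_bdry_iff f (hγ T hTT).1 (hγ T hTT).2).1 hbT
    -- height `0` is reached only at time `0`
    refine ((flip_eq_zero_or_iff r0 (y T)).2 h).resolve_left fun h0 => ?_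
    rw [h0, riseTime_zero] at hRT
    exact hT.ne hRT
  have hyT : y T = flip r0 (2 * Real.pi) := by rw [← hend, flip_flip]
  refine ⟨c, hc, r0, x 0, ?_⟩
  rw [hcl T hTT, hyT, f.flip_apply, f.two_pi, div_one] at hu1
  rw [hend] at hRT hxT
  change (tangentVec (γ 0) u₀, tangentVec (γ T) u₁, T) = _
  rw [hu0, hu1, (hγ 0 h0T).2, (hγ T hTT).2, hr, hyT, hxT, crossingData, hRT]

/-- For every Clairaut constant `c` with `|c| < 1`, the curve given by `geodesicShift` and
`geodesicHeight` is a geodesic that crosses the strip. -/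
lemma crossingData_mem_exitData {c : ℝ} (hc : |c| < 1) (r : Bool) (x : ℝ) :
    crossingData b f c r x ∈ (surface b f).exitData := by
  set T := riseTime f c (2 * Real.pi) with hTdef
  have hT : 0 < T := riseTime_pos f hc Real.two_pi_pos
  have h0T : (0 : ℝ) ∈ Icc 0 T := left_mem_Icc.2 hT.le
  have hTT : T ∈ Icc 0 T := right_mem_Icc.2 hT.le
  have hsq := flipSign_mul_self r
  let X : ℝ → ℝ := fun t => x + geodesicShift f hc t
  let Y : ℝ → ℝ := fun t => flip r (geodesicHeight f hc t)
  let γ : ℝ → surface b f := fun t => stripProj b (X t, Y t)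
  have hγ : ∀ t ∈ Icc 0 T, (X t, Y t) ∈ strip ∧ γ t = stripProj b (X t, Y t) := fun t ht =>
    ⟨⟨mem_univ _, flip_mem r (geodesicHeight_mem f hc ht)⟩, rfl⟩
  have hX2 : ContDiff ℝ 2 X := contDiff_const.add (contDiff_geodesicShift f hc)
  have hY2 : ContDiff ℝ 2 Y := (contDiff_flip r).comp (contDiff_geodesicHeight f hc)
  have hX : ∀ t, HasDerivAt X (c / f (geodesicHeight f hc t)) t := fun t =>
    (hasDerivAt_geodesicShift f hc t).const_add x
  have hY : ∀ t, HasDerivAt Y (flipSign r * normalSpeed f c (geodesicHeight f hc t)) t := fun t =>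
    (hasDerivAt_flip r _).comp t (hasDerivAt_geodesicHeight f hc t)
  have hXd : ∀ t ∈ Icc 0 T, derivWithin X (Icc 0 T) t = c / f (geodesicHeight f hc t) :=
    fun t ht => (hX t).hasDerivWithinAt.derivWithin (uniqueDiffOn_Icc hT t ht)
  have hYd : ∀ t ∈ Icc 0 T,
      derivWithin Y (Icc 0 T) t = flipSign r * normalSpeed f c (geodesicHeight f hc t) :=
    fun t ht => (hY t).hasDerivWithinAt.derivWithin (uniqueDiffOn_Icc hT t ht)
  have hvel : ∀ t ∈ Icc 0 T, ∃ r', flip r' (Y t) < 2 * Real.pi ∧ (surface b f).velocity γ T t =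
      coordDeriv r' (c / f (geodesicHeight f hc t),
        flipSign r * normalSpeed f c (geodesicHeight f hc t)) := fun t ht => by
    obtain ⟨r', a, h1, h⟩ := exists_extChartAt_eq (hγ t ht).1 (hγ t ht).2
    exact ⟨r', h1, exists_velocity_eq f hT ht (c := fun t => (X t, Y t)) hγ
      ((hX t).prodMk (hY t)).hasDerivWithinAt h⟩
  have hX0 : X 0 = x := by simp [X, geodesicShift, geodesicHeight_zero]
  have hY0 : Y 0 = flip r 0 := by simp [Y, geodesicHeight_zero]
  have hHT : geodesicHeight f hc T = 2 * Real.pi := geodesicHeight_riseTime f hc _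
  have hXT : X T = x + riseShift f c (2 * Real.pi) := by simp [X, geodesicShift, hHT]
  have hYT : Y T = flip r (2 * Real.pi) := by simp [Y, hHT]
  obtain ⟨r0, hr0, hv0⟩ := hvel 0 h0T
  obtain ⟨rT, -, hvT⟩ := hvel T hTT
  rw [hY0] at hr0
  obtain rfl := eq_of_flip_flip_zero_lt hr0
  have hbdry : ∀ t ∈ Icc 0 T, γ t ∈ (surface b f).bdry ↔
      geodesicHeight f hc t = 0 ∨ geodesicHeight f hc t = 2 * Real.pi := fun t ht =>
    (mem_bdry_iff f (hγ t ht).1 (hγ t ht).2).trans (flip_eq_zero_or_iff _ _)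
  refine ⟨γ, T, (!₂[0, c] : EuclideanSpace ℝ (Fin 2)), (!₂[0, c] : EuclideanSpace ℝ (Fin 2)), hT,
    ⟨?_, ?_, ?_⟩, ?_, ?_, ?_, ?_, ?_, ?_, ?_⟩
  · exact contMDiffOn_of_lift (b := b) (c := fun t => (X t, Y t)) hγ
      (hX2.prodMk hY2).contDiffOn
  · intro t ht
    refine (inner_velocity f hT ht (c := fun t => (X t, Y t)) hγ
      ((hX t).prodMk (hY t)).hasDerivWithinAt).trans ?_
    simp only [Y, f.flip_apply]
    rw [← geodesic_speed f hc (geodesicHeight f hc t)]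
    linear_combination normalSpeed f c (geodesicHeight f hc t) ^ 2 * hsq
  · intro t ht
    refine (geodesic_equation_iff f hT ht hγ hX2.contDiffOn hY2.contDiffOn).2 ⟨?_, ?_⟩
    · rw [iteratedDerivWithin_two_eq hT ht hY
        ((hasDerivAt_geodesicHeight_deriv f hc t).const_mul _), hXd t ht]
      simp only [Y, deriv_flip_apply]
      ring
    · rw [iteratedDerivWithin_two_eq hT ht hX (hasDerivAt_geodesicShift_deriv f hc t), hXd t ht,
        hYd t ht]
      simp only [Y, deriv_flip_apply, f.flip_apply]
      linear_combination (deriv f (geodesicHeight f hc t) / f (geodesicHeight f hc t) *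
        normalSpeed f c (geodesicHeight f hc t) * (c / f (geodesicHeight f hc t))) * hsq
  · exact (hbdry 0 h0T).2 (Or.inl (geodesicHeight_zero f hc))
  · exact (hbdry T hTT).2 (Or.inr hHT)
  · intro t ht
    rw [hbdry t (Ioo_subset_Icc_self ht), not_or]
    constructor
    · rw [← geodesicHeight_zero f hc]
      exact ((geodesicHeight f hc).strictMono ht.1).ne'
    · rw [← hHT]
      exact ((geodesicHeight f hc).strictMono ht.2).ne
  · rw [hv0]
    refine (pointsInwards_iff f _ _).2 ?_
    rw [coordDeriv_zero, ← mul_assoc, hsq, one_mul]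
    exact normalSpeed_pos f hc _
  · rw [hv0]
    refine (isBdryProjection_iff f _ _ _).2 ?_
    rw [coordDeriv_one, geodesicHeight_zero, f.zero, div_one]
  · rw [hvT]
    refine (isBdryProjection_iff f _ _ _).2 ?_
    rw [coordDeriv_one, hHT, f.two_pi, div_one]
  · change _ = (tangentVec (stripProj b (X 0, Y 0)) _, tangentVec (stripProj b (X T, Y T)) _, T)
    rw [hX0, hY0, hXT, hYT]
    rfl

/-- The set `Ω'` consists of the lens data of the crossing geodesics. -/
lemma mem_exitData_iff
    {d : TangentBundle (𝓡∂ 2) (StripQuotient b) × TangentBundle (𝓡∂ 2) (StripQuotient b) × ℝ} :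
    d ∈ (surface b f).exitData ↔ ∃ c, |c| < 1 ∧ ∃ r x, d = crossingData b f c r x := by
  refine ⟨exists_crossingData_of_mem_exitData f, ?_⟩
  rintro ⟨c, hc, r, x, rfl⟩
  exact crossingData_mem_exitData f hc r x

lemma Profile.Matches.crossingData_eq {f g : Profile} (h : f.Matches g) {c : ℝ} (hc : |c| < 1)
    (r : Bool) (x : ℝ) : crossingData b f c r x = crossingData b g c r x := by
  rw [crossingData, crossingData, h.riseTime_eq c hc, h.riseShift_eq c hc]

end

section

open Topology Filter AnalyticRiemannianManifold

variable {b : Bool} (f g : Profile)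

/-! ### The isometry of the boundaries -/

lemma exists_bdry_eq {p : StripQuotient b} (hp : p ∈ (surface b f).bdry) :
    ∃ x r, stripProj b (x, flip r 0) = p := by
  obtain ⟨z, hz, rfl⟩ := exists_stripProj_eq p
  rcases (mem_bdry_iff f hz rfl).1 hp with h | h
  · exact ⟨z.1, false, by rw [show flip false 0 = z.2 from h.symm]⟩
  · exact ⟨z.1, true, by rw [show flip true 0 = z.2 by rw [h]; simp [flip]]⟩

lemma flip_zero_mem (x : ℝ) (r : Bool) : (x, flip r 0) ∈ strip :=
  ⟨mem_univ _, flip_mem r (left_mem_Icc.2 Real.two_pi_pos.le)⟩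

lemma stripProj_flip_zero_mem_bdry (x : ℝ) (r : Bool) :
    stripProj b (x, flip r 0) ∈ (surface b f).bdry :=
  (mem_bdry_iff f (flip_zero_mem x r) rfl).2 ((flip_eq_zero_or_iff r 0).2 (Or.inl rfl))

lemma warp_height_bdry {p : StripQuotient b} (hp : p ∈ (surface b f).bdry) : g (height p) = 1 := by
  obtain ⟨x, r, rfl⟩ := exists_bdry_eq f hp
  rw [warp_height g (flip_zero_mem x r), g.flip_apply, g.zero]

/-- The identity of the boundary fixes tangential vectors, because it fixes the velocities of the
curves `t ↦ (x + t, y)` of the boundary. -/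
lemma mfderivWithin_id_bdry {p : StripQuotient b} (hp : p ∈ (surface b f).bdry)
    {v : EuclideanSpace ℝ (Fin 2)} (hv : v 0 = 0) :
    mfderivWithin (𝓡∂ 2) (𝓡∂ 2) (id : StripQuotient b → StripQuotient b) (surface b f).bdry p v =
      v := by
  obtain ⟨x, r, rfl⟩ := exists_bdry_eq f hp
  -- compare the velocity of this curve with that of its image under the identity
  let c : ℝ → ℝ × ℝ := fun t => (x + t * v 1, flip r 0)
  have hc0 : c 0 = (x, flip r 0) := by simp [c]
  have hγ : ∀ t ∈ (univ : Set ℝ), c t ∈ strip ∧ stripProj b (c t) = stripProj b (c t) :=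
    fun t _ => ⟨flip_zero_mem _ r, rfl⟩
  have hc : HasDerivWithinAt c (v 1, 0) univ 0 := by
    have h1 : HasDerivAt (fun t : ℝ => x + t * v 1) (v 1) 0 := by
      simpa using ((hasDerivAt_id (0 : ℝ)).mul_const (v 1)).const_add x
    exact (h1.prodMk (hasDerivAt_const 0 (flip r 0))).hasDerivWithinAt
  obtain ⟨r', a, -, h⟩ := exists_extChartAt_eq (b := b) (flip_zero_mem x r) rfl
  rw [← hc0] at h ⊢
  have h1 := hasMFDerivWithinAt_of_lift (γ := fun t => stripProj b (c t)) (mem_univ 0) hγ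
    hc.hasFDerivWithinAt h
  have h2 : HasMFDerivWithinAt (𝓡∂ 2) (𝓡∂ 2) (id : StripQuotient b → StripQuotient b)
      (surface b f).bdry (stripProj b (c 0)) _ :=
    mdifferentiableWithinAt_id.hasMFDerivWithinAt
  have h3 := HasMFDerivWithinAt.comp (f := fun t => stripProj b (c t)) 0 h2 h1
    fun t _ => stripProj_flip_zero_mem_bdry f _ r
  have h4 := congrArg (fun L => L (1 : ℝ)) 
    (UniqueMDiffWithinAt.eq (uniqueMDiffWithinAt_univ _) h3 h1)
  have h5 : (coordDeriv r').comp (ContinuousLinearMap.toSpanSingleton ℝ ((v 1, 0) : ℝ × ℝ)) 1 =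
      v := by
    ext i
    fin_cases i
    · simp [hv]
    · simp
  exact ((congrArg _ h5).symm.trans h4).trans h5

/-- The identity of the boundary, as an isometry between the boundaries for two warping
functions. -/
def boundaryIsometry (b : Bool) (f g : Profile) :
    BoundaryIsometry (surface b f) (surface b g) where
  toFun := (id : StripQuotient b → StripQuotient b)
  bijOn := bijOn_id (surface b f).bdry
  contMDiffOn := contMDiffOn_id (M := StripQuotient b)
  isometry p hp v w hv hw := by
    refine (congrArg₂ (diagForm (g (height (b := b) p)) · ·) (mfderivWithin_id_bdry f hp hv)
      (mfderivWithin_id_bdry f hp hw)).trans ?_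
    rw [warp_height_bdry f g hp, ← warp_height_bdry f f hp]
    rfl

lemma boundaryIsometry_push {p : StripQuotient b} (hp : p ∈ (surface b f).bdry) (c : ℝ) :
    (boundaryIsometry b f g).push (tangentVec p !₂[0, c]) = tangentVec p !₂[0, c] :=
  congrArg (tangentVec p) (mfderivWithin_id_bdry f hp (v := !₂[0, c]) rfl)

/-- The differential of the boundary isometry preserves the lens data of `f`, since the tangential
velocities have the same coordinates `(0, c)` for both metrics. -/
lemma push_crossingData (c : ℝ) (r : Bool) (x : ℝ) :
    ((boundaryIsometry b f g).push (crossingData b f c r x).1,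
      (boundaryIsometry b f g).push (crossingData b f c r x).2.1,
      (crossingData b f c r x).2.2) = crossingData b f c r x := by
  have h : stripProj b (x + riseShift f c (2 * Real.pi), flip r (2 * Real.pi)) ∈
      (surface b f).bdry :=
    (mem_bdry_iff f ⟨mem_univ _, flip_mem r (right_mem_Icc.2 Real.two_pi_pos.le)⟩ rfl).2
      ((flip_eq_zero_or_iff r _).2 (Or.inr rfl))
  exact congrArg₂ Prod.mk (boundaryIsometry_push f g (stripProj_flip_zero_mem_bdry f x r) c)
    (congrArg₂ Prod.mk (boundaryIsometry_push f g h c) rfl)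

variable {f g}

lemma Profile.Matches.sameLensData (h : f.Matches g) :
    (boundaryIsometry b f g).SameLensData := by
  constructor
  · ext d
    refine Iff.trans ?_ (mem_exitData_iff g).symm
    constructor
    · rintro ⟨d, hd, rfl⟩
      obtain ⟨c, hc, r, x, rfl⟩ := (mem_exitData_iff f).1 hd
      exact ⟨c, hc, r, x, (push_crossingData f g c r x).trans (h.crossingData_eq hc r x)⟩
    · rintro ⟨c, hc, r, x, rfl⟩
      exact ⟨crossingData b f c r x, crossingData_mem_exitData f hc r x,
        (push_crossingData f g c r x).trans (h.crossingData_eq hc r x)⟩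
  · intro p hp q hq
    exact le_antisymm (h.tau_le hp hq) (h.symm.tau_le hp hq)

end

section

open Topology Filter AnalyticRiemannianManifold

variable {b : Bool} (f : Profile)

/-! ### Boundary normal coordinates and jets -/

@[simp] lemma withNormal_zero (u : EuclideanSpace ℝ (Fin 2)) (t : ℝ) : withNormal u t 0 = t := rfl

@[simp] lemma withNormal_one (u : EuclideanSpace ℝ (Fin 2)) (t : ℝ) : withNormal u t 1 = u 1 := rfl

/-- A vertical segment is a path of unit speed. -/
lemma tau_vertical_le (r : Bool) (x : ℝ) {t : ℝ} (ht : t ∈ Icc 0 (2 * Real.pi)) :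
    (surface b f).tau (stripProj b (x, flip r t)) (stripProj b (x, flip r 0)) ≤
      ENNReal.ofReal t := by
  have h := tau_le_of_unit_speed (b := b) f ht.1 (x := fun _ => x) (x' := fun _ => 0)
    (y := fun s => flip r (t - s)) (y' := fun _ => flipSign r * -1)
    (fun s _ => (hasDerivAt_const s x).hasDerivWithinAt)
    (fun s _ => ((hasDerivAt_flip r (t - s)).comp s
      ((hasDerivAt_id s).const_sub t)).hasDerivWithinAt)
    continuousOn_const continuousOn_const
    (fun s hs => ⟨mem_univ _, flip_mem r ⟨sub_nonneg.2 hs.2, (sub_le_self _ hs.1).trans ht.2⟩⟩)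
    (fun s _ => by linear_combination flipSign_mul_self r)
  simpa using h

/-- The distance from the boundary is measured along vertical segments. -/
lemma le_tau_of_mem_bdry (r : Bool) (x : ℝ) {t : ℝ} (ht : t ∈ Icc 0 Real.pi) {q : StripQuotient b}
    (hq : q ∈ (surface b f).bdry) :
    ENNReal.ofReal t ≤ (surface b f).tau (stripProj b (x, flip r t)) q := by
  refine le_of_forall_gt fun ρ hρ => ?_
  obtain ⟨ρ', hρ', hρ''⟩ := exists_between hρ
  refine lt_of_le_of_lt ?_ hρ''
  have hpi := Real.pi_pos
  obtain ⟨w, hw, rfl, h⟩ := exists_lift_of_tau_lt f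
    ⟨mem_univ _, flip_mem r ⟨ht.1, by linarith [ht.2]⟩⟩ hρ'
  have hsq := flipSign_mul_self r
  rcases (flip_eq_zero_or_iff r w.2).2 ((mem_bdry_iff f hw rfl).1 hq) with h0 | h0
  · have := h 0 (fun y => -flip r y) (fun _ => -flipSign r) (fun y => (hasDerivAt_flip r y).neg)
      continuous_const (fun y => by
        rw [zero_pow two_ne_zero, zero_div, zero_add, neg_sq, sq, hsq])
    simpa [flip_flip, h0] using this
  · have := h 0 (flip r) (fun _ => flipSign r) (hasDerivAt_flip r) continuous_const
      (fun y => by rw [zero_pow two_ne_zero, zero_div, zero_add, sq, hsq])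
    refine le_trans (ENNReal.ofReal_le_ofReal ?_) this
    simp only [flip_flip, h0]
    linarith [ht.2]

lemma exists_box_subset {u : EuclideanSpace ℝ (Fin 2)} {p : EuclideanSpace ℝ (Fin 2) → Prop}
    (h : ∀ᶠ v in 𝓝[range (𝓡∂ 2)] u, p v) :
    ∃ ε > 0, ∀ v : EuclideanSpace ℝ (Fin 2), 0 ≤ v 0 → |v 0 - u 0| < ε → |v 1 - u 1| < ε →
      p v := by
  rw [eventually_nhdsWithin_iff, Metric.eventually_nhds_iff] at h
  obtain ⟨ε, hε, h⟩ := h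
  refine ⟨ε / 2, half_pos hε, fun v hv h0 h1 => h ?_ ?_⟩
  · rw [EuclideanSpace.dist_eq, Fin.sum_univ_two, Real.sqrt_lt' hε, Real.dist_eq, Real.dist_eq]
    nlinarith [abs_nonneg (v 0 - u 0), abs_nonneg (v 1 - u 1)]
  · rw [range_modelWithCornersEuclideanHalfSpace]
    exact hv

/-- The preferred chart at a boundary point restricts to boundary normal coordinates, for every
warping function, and in these coordinates the tangential component of the metric is the warping
function. -/
lemma exists_isBoundaryNormalChart (x : ℝ) (r₀ : Bool) :
    ∃ φ : OpenPartialHomeomorph (StripQuotient b) (EuclideanHalfSpace 2),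
      stripProj b (x, flip r₀ 0) ∈ φ.source ∧ ∀ f : Profile,
        (surface b f).IsBoundaryNormalChart φ ∧
        ∀ᶠ t in 𝓝[Ici 0] (0 : ℝ), (surface b f).metricCoeff φ
          (withNormal (φ.extend (𝓡∂ 2) (stripProj b (x, flip r₀ 0))) t) 1 1 = f t := by
  set p := stripProj b (x, flip r₀ 0) with hp
  set e := chartAt (EuclideanHalfSpace 2) p
  have he : e ∈ atlas (EuclideanHalfSpace 2) (StripQuotient b) := chart_mem_atlas _ p
  have hpe : p ∈ e.source := mem_chart_source _ p
  obtain ⟨r, s, h1, h2, h3⟩ := exists_symm_eq_stripProj he (flip_zero_mem x r₀) hpe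
  rw [← hp] at h1
  set u := e.extend (𝓡∂ 2) p with hu
  have hu0 : u 0 = 0 := by
    obtain ⟨r', a, h4, h5⟩ := exists_extChartAt_eq (b := b) (flip_zero_mem x r₀) rfl
    have h6 := h5.self_of_nhdsWithin (flip_zero_mem x r₀)
    have h7 : u = coord r' a (x, flip r₀ 0) := h6
    rw [h7, coord_zero, eq_of_flip_flip_zero_lt h4, flip_flip]
  -- the chart is restricted to a box in its coordinates, which contains the feet of its points
  have h4 : ∀ᶠ v in 𝓝[range (𝓡∂ 2)] u, v ∈ (e.extend (𝓡∂ 2)).target :=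
    e.extend_target_mem_nhdsWithin hpe
  rw [← h1] at h3
  obtain ⟨ε, hε, hbox⟩ := exists_box_subset (h3.and h4)
  rw [hu0] at hbox
  -- below height `π`, the side `flip r y = 0` is the closer one
  set δ := min ε Real.pi
  have hδ : 0 < δ := lt_min hε Real.pi_pos
  let O : Set (EuclideanHalfSpace 2) := {a | a.val 0 < δ ∧ |a.val 1 - u 1| < δ}
  have hO : IsOpen O := by
    have hc : ∀ i, Continuous fun a : EuclideanHalfSpace 2 => a.val i := fun i =>
      (EuclideanSpace.proj (𝕜 := ℝ) i).continuous.comp continuous_subtype_val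
    exact (isOpen_lt (hc 0) continuous_const).inter
      (isOpen_lt ((hc 1).sub continuous_const).abs continuous_const)
  have hopen : IsOpen (e.source ∩ e ⁻¹' O) := e.isOpen_inter_preimage hO
  let φ := e.restr (e.source ∩ e ⁻¹' O)
  have hφ : φ.source = e.source ∩ e ⁻¹' O := by
    rw [e.restr_source, hopen.interior_eq, ← inter_assoc, inter_self]
  have hφe : ∀ q, φ.extend (𝓡∂ 2) q = e.extend (𝓡∂ 2) q := fun _ => rfl
  have hval : ∀ q, (e q).val = e.extend (𝓡∂ 2) q := fun _ => rfl
  have hgood : ∀ v : EuclideanSpace ℝ (Fin 2), 0 ≤ v 0 → v 0 < δ → |v 1 - u 1| < δ →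
      v ∈ (e.extend (𝓡∂ 2)).target ∧ v ∈ (φ.extend (𝓡∂ 2)).target ∧
        (e.extend (𝓡∂ 2)).symm v = stripProj b (v 1 - s, flip r (v 0)) := by
    intro v hv hv0 hv1
    have h := hbox v hv (by rw [sub_zero, abs_of_nonneg hv]; exact hv0.trans_le (min_le_left _ _))
      (hv1.trans_le (min_le_left _ _))
    have h5 := (e.extend (𝓡∂ 2)).right_inv h.2
    have h6 := (e.extend (𝓡∂ 2)).map_target h.2
    rw [e.extend_source] at h6
    have h7 : (e.extend (𝓡∂ 2)).symm v ∈ φ.source := by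
      rw [hφ]
      refine ⟨h6, ?_⟩
      change (e ((e.extend (𝓡∂ 2)).symm v)).val 0 < δ ∧
        |(e ((e.extend (𝓡∂ 2)).symm v)).val 1 - u 1| < δ
      rw [hval, h5]
      exact ⟨hv0, hv1⟩
    have h8 := (φ.extend (𝓡∂ 2)).map_source (by rwa [φ.extend_source])
    rw [hφe, h5] at h8
    exact ⟨h.2, h8, h.1.2⟩
  have hpφ : p ∈ φ.source := by
    rw [hφ]
    refine ⟨hpe, ?_⟩
    change (e p).val 0 < δ ∧ |(e p).val 1 - u 1| < δ
    rw [hval, ← hu, hu0, sub_self, abs_zero]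
    exact ⟨hδ, hδ⟩
  refine ⟨φ, hpφ, fun f => ⟨?_, ?_⟩⟩
  · have key : ∀ q ∈ φ.source, φ.extend (𝓡∂ 2) q 0 ∈ Icc 0 Real.pi ∧
        withNormal (φ.extend (𝓡∂ 2) q) 0 ∈ (φ.extend (𝓡∂ 2)).target ∧
        stripProj b (φ.extend (𝓡∂ 2) q 1 - s, flip r (φ.extend (𝓡∂ 2) q 0)) = q ∧
        (φ.extend (𝓡∂ 2)).symm (withNormal (φ.extend (𝓡∂ 2) q) 0) =
          stripProj b (φ.extend (𝓡∂ 2) q 1 - s, flip r 0) := by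
      intro q hq
      rw [hφ] at hq
      obtain ⟨hqe, hq0, hq1⟩ := hq
      rw [hval] at hq0 hq1
      have hnn : 0 ≤ e.extend (𝓡∂ 2) q 0 := (e q).property
      obtain ⟨-, -, h5⟩ := hgood _ hnn hq0 hq1
      obtain ⟨-, h6, h7⟩ := hgood (withNormal (e.extend (𝓡∂ 2) q) 0) le_rfl hδ hq1
      exact ⟨⟨hnn, (hq0.trans_le (min_le_right _ _)).le⟩, h6,
        h5.symm.trans (e.extend_left_inv hqe), h7⟩
    have hdist : ∀ (X : ℝ) {t : ℝ}, t ∈ Icc 0 Real.pi →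
        (surface b f).distToBdry (stripProj b (X, flip r t)) = ENNReal.ofReal t ∧
        (surface b f).tau (stripProj b (X, flip r t)) (stripProj b (X, flip r 0)) =
          ENNReal.ofReal t := by
      intro X t ht
      have hle := tau_vertical_le (b := b) f r X ⟨ht.1, by linarith [ht.2, Real.pi_pos]⟩
      have hmem := stripProj_flip_zero_mem_bdry (b := b) f X r
      exact ⟨le_antisymm ((iInf₂_le _ hmem).trans hle)
        (le_iInf₂ fun q hq => le_tau_of_mem_bdry f r X ht hq),
        le_antisymm hle (le_tau_of_mem_bdry f r X ht hmem)⟩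
    refine ⟨restr_mem_maximalAtlas (contDiffGroupoid ω (𝓡∂ 2))
      (IsManifold.subset_maximalAtlas he) hopen, fun q hq => ?_, fun q hq => (key q hq).2.1,
      fun q hq => ?_, fun q hq => ?_⟩
    all_goals obtain ⟨h6, -, h8, h9⟩ := key q hq
    · exact (congrArg (surface b f).distToBdry h8).symm.trans (hdist _ h6).1
    · exact mem_of_eq_of_mem h9 (stripProj_flip_zero_mem_bdry f _ r)
    · exact (congrArg₂ (surface b f).tau h8.symm h9).trans ((hdist _ h6).2.trans
        ((hdist _ h6).1.symm.trans (congrArg (surface b f).distToBdry h8)))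
  · have h5 : ∀ᶠ t in 𝓝[Ici 0] (0 : ℝ), t < δ :=
      mem_nhdsWithin_of_mem_nhds (Iio_mem_nhds hδ)
    filter_upwards [h5, self_mem_nhdsWithin] with t ht ht0
    obtain ⟨h6, -, -⟩ := hgood (withNormal u t) ht0 ht (by simpa using hδ)
    refine (metricCoeff_eq f he h6 1 1).trans ?_
    simp

lemma iteratedDeriv_two_cosProfile (k : ℕ) : iteratedDeriv 2 (cosProfile k) 0 = k ^ 2 := by
  have h1 : deriv (cosProfile k) = fun y => k * Real.sin (k * y) := funext fun y => by
    have h : HasDerivAt (fun y : ℝ => k * y) (k : ℝ) y := by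
      simpa using (hasDerivAt_id y).const_mul (k : ℝ)
    exact ((h.cos.const_sub 2).congr_deriv (by ring)).deriv
  have h2 : HasDerivAt (fun y : ℝ => k * y) (k : ℝ) 0 := by
    simpa using (hasDerivAt_id (0 : ℝ)).const_mul (k : ℝ)
  rw [iteratedDeriv_succ, iteratedDeriv_one, h1, (h2.sin.const_mul (k : ℝ)).deriv]
  simp [sq]

/-- The tangential component of the metric has, at the boundary, the second normal derivative `1`
for one profile and `4` for the other. -/
lemma not_jetsAgreeAt {p : StripQuotient b} (hp : p ∈ (surface b (cosProfile 1)).bdry) :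
    ¬ (boundaryIsometry b (cosProfile 1) (cosProfile 2)).JetsAgreeAt 2 p := by
  obtain ⟨x, r, rfl⟩ := exists_bdry_eq _ hp
  obtain ⟨φ, hpφ, hφ⟩ := exists_isBoundaryNormalChart (b := b) x r
  have hjet : ∀ k, (surface b (cosProfile k)).jetCoeff φ (stripProj b (x, flip r 0)) 2 1 1 =
      k ^ 2 := fun k => by
    have h : _ =ᶠ[𝓝[Ici 0] (0 : ℝ)] cosProfile k := (hφ (cosProfile k)).2
    refine (h.iteratedDerivWithin_eq (h.self_of_nhdsWithin self_mem_Ici)).trans ?_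
    rw [← iteratedDeriv_two_cosProfile]
    exact iteratedDerivWithin_eq_iteratedDeriv (uniqueDiffOn_Ici 0)
      ((cosProfile k).contDiff.of_le le_top).contDiffAt self_mem_Ici
  intro h
  have h1 := h φ φ (hφ _).1 (hφ _).1 hpφ (fun q hq => ⟨hq.2, rfl⟩) 2 le_rfl 1 1
  have h2 := ((hjet 1).symm.trans h1).trans (hjet 2)
  norm_num at h2

end

end WarpedStrip

end

theorem mainTheorem4 (σ : Equiv.Perm (ℝ × ℝ)) (hσ : σ = slide ∨ σ = glide) :
    ∃ (M₁ M₂ : AnalyticRiemannianManifold 2) (P₁ : ℝ × ℝ → M₁) (P₂ : ℝ × ℝ → M₂)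
      (h : AnalyticRiemannianManifold.BoundaryIsometry M₁ M₂),
      IsStripQuotient (fun y => 2 - Real.cos y) σ M₁ P₁ ∧
      IsStripQuotient (fun y => 2 - Real.cos (2 * y)) σ M₂ P₂ ∧
      (∀ z ∈ strip, P₁ z ∈ M₁.bdry → h.toFun (P₁ z) = P₂ z) ∧
      h.SameLensData ∧
      ∀ p ∈ M₁.bdry, ¬ h.JetsAgreeAt 2 p := by
  obtain ⟨b, rfl⟩ : ∃ b, σ = WarpedStrip.generator b := by
    rcases hσ with rfl | rfl
    · exact ⟨false, rfl⟩
    · exact ⟨true, rfl⟩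
  have h1 : (fun y => 2 - Real.cos y) = WarpedStrip.cosProfile 1 := by
    simp [WarpedStrip.cosProfile]
  have h2 : (fun y => 2 - Real.cos (2 * y)) = WarpedStrip.cosProfile 2 := by
    simp [WarpedStrip.cosProfile]
  rw [h1, h2]
  exact ⟨WarpedStrip.surface b (WarpedStrip.cosProfile 1),
    WarpedStrip.surface b (WarpedStrip.cosProfile 2),
    WarpedStrip.stripProj b, WarpedStrip.stripProj b,
    WarpedStrip.boundaryIsometry b _ _,
    WarpedStrip.isStripQuotient_surface b _, WarpedStrip.isStripQuotient_surface b _,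
    fun _ _ _ => rfl, WarpedStrip.matches_cosProfile.sameLensData,
    fun _ hp => WarpedStrip.not_jetsAgreeAt hp⟩
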